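/- Let $L>0$. There is a function $K_2$ (depending on the fixed length $L$ only) such that the following holds for all $0<v<1$, all $S>0$, all $\phi^0\in H^1_0(0,L)$ and $\phi^1\in L^2(0,L)$. Put $\mathbf I_t=(vt,L+vt)$ and let $\phi$ be the weak solution on $[0,S]$ of $$\phi_{tt}-\phi_{xx}=0\ \ (x\in\mathbf I_t,\ 0<t<S),\qquad \phi(vt,t)=\phi(L+vt,t)=0,\qquad \phi(\cdot,0)=\phi^0,\ \ \phi_t(\cdot,0)=\phi^1\ \text{ on }(0,L),$$ that is, $\phi\in C([0,S];H^1_0(\mathbf I_t))$, $\phi_t\in C([0,S];L^2(\mathbf I_t))$, and the wave equation holds in the sense of distributions. Let $$\mathcal E_v(t)=\frac12\int_{vt}^{L+vt}\Big[(\phi_t+v\phi_x)^2+(1-v^2)\phi_x^2\Big]\,dx .$$ Then for almost every $t\in(0,S)$ the one-sided $x$-derivatives $\phi_x(vt,t)$ and $\phi_x(L+vt,t)$ at the endpoints exist, they are square integrable in $t$ over $(0,S)$, and: 1. if $S\ge \frac{L}{1-v}$, then $$\int_0^{L/(1+v)}\phi_x^2(vt,t)\,dt+\int_0^{L/(1-v)}\phi_x^2(L+vt,t)\,dt=\frac{4\,\mathcal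 E_v(0)}{(1-v^2)^2};$$ 2. (direct inequality) for every $0\le T\le S$, $$\int_0^T\big[\phi_x^2(vt,t)+\phi_x^2(L+vt,t)\big]\,dt\le K_2(v,T)\,\mathcal E_v(0);$$ 3. (observability from both endpoints) for every $T$ with $\frac{L}{1-v}\le T\le S$, $$\mathcal E_v(0)\le\frac{(1-v^2)^2}{4}\int_0^T\big[\phi_x^2(vt,t)+\phi_x^2(L+vt,t)\big]\,dt .$$ -/

import Mathlib

open MeasureTheory Set Filter Topology
open scoped ContDiff

namespace TravellingString

/-- `f ∈ H₀¹(a, b)` with derivative `f' ∈ L²(a, b)`. On a bounded interval an element of `H₀¹` is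
represented by its absolutely continuous representative on `[a, b]`, that is, by the primitive of
its `L²` weak derivative, and it vanishes at both endpoints. -/
structure MemH10 (a b : ℝ) (f f' : ℝ → ℝ) : Prop where
  memLp_deriv : MemLp f' 2 (volume.restrict (Ioo a b))
  eq_integral : ∀ x ∈ Icc a b, f x = ∫ s in a..x, f' s
  right_eq_zero : f b = 0

/-- `f ∈ C([0, S]; L²(I_t))` with `I_t = (v t, L + v t)`. The spaces `L²(I_t)` are identified with
`L²(0, L)` by the translation `x = y + v t`. -/
structure ContinuousInL2 (L v S : ℝ) (f : ℝ → ℝ → ℝ) : Prop where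
  memLp : ∀ t ∈ Icc 0 S,
    MemLp (fun y => f (y + v * t) t) 2 (volume.restrict (Ioo 0 L))
  tendsto : ∀ t₀ ∈ Icc 0 S,
    Tendsto
      (fun t => eLpNorm (fun y => f (y + v * t) t - f (y + v * t₀) t₀) 2
        (volume.restrict (Ioo 0 L)))
      (𝓝[Icc 0 S] t₀) (𝓝 0)

/-- The space-time domain `{(x, t) : 0 < t < S, v t < x < L + v t}`. -/
def domain (L v S : ℝ) : Set (ℝ × ℝ) :=
  {p | p.2 ∈ Ioo 0 S ∧ p.1 ∈ Ioo (v * p.2) (L + v * p.2)}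

/-- `η ∈ C_c^∞` of the space-time domain. -/
structure IsTestFunction (L v S : ℝ) (η : ℝ → ℝ → ℝ) : Prop where
  contDiff : ContDiff ℝ ∞ (fun p : ℝ × ℝ => η p.1 p.2)
  hasCompactSupport : HasCompactSupport (fun p : ℝ × ℝ => η p.1 p.2)
  tsupport_subset : tsupport (fun p : ℝ × ℝ => η p.1 p.2) ⊆ domain L v S

/-- `φ` is the finite energy (weak) solution, on the time interval `[0, S]`, of
`φ_tt - φ_xx = 0` in `I_t = (v t, L + v t)`, `φ = 0` at `x = v t` and `x = L + v t`,
`φ(·, 0) = φ0`, `φ_t(·, 0) = φ1`; the functions `φx` and `φt` are its weak derivatives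
with respect to `x` and `t`. -/
structure IsSolution (L v S : ℝ) (φ0 φ1 : ℝ → ℝ) (φ φx φt : ℝ → ℝ → ℝ) : Prop where
  /-- `φ(·, t) ∈ H₀¹(I_t)`, with derivative `φx(·, t)`; this contains the boundary conditions. -/
  memH10 : ∀ t ∈ Icc 0 S,
    MemH10 (v * t) (L + v * t) (fun x => φ x t) (fun x => φx x t)
  /-- The next two fields: `φ ∈ C([0, S]; H₀¹(I_t))`. -/
  continuous_self : ContinuousInL2 L v S φ
  continuous_dx : ContinuousInL2 L v S φx
  /-- `φ_t ∈ C([0, S]; L²(I_t))`. -/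
  continuous_dt : ContinuousInL2 L v S φt
  /-- `φt` is the distributional time derivative of `φ`. -/
  weak_dt : ∀ η : ℝ → ℝ → ℝ, IsTestFunction L v S η →
    ∫ t in (0 : ℝ)..S, ∫ x in (v * t)..(L + v * t), φ x t * deriv (fun s => η x s) t =
      - ∫ t in (0 : ℝ)..S, ∫ x in (v * t)..(L + v * t), φt x t * η x t
  /-- `φ_tt - φ_xx = 0` in the sense of distributions. -/
  weak_wave : ∀ η : ℝ → ℝ → ℝ, IsTestFunction L v S η →
    ∫ t in (0 : ℝ)..S, ∫ x in (v * t)..(L + v * t),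
      φ x t * (iteratedDeriv 2 (fun s => η x s) t - iteratedDeriv 2 (fun y => η y t) x) = 0
  initial_position : ∀ x ∈ Icc 0 L, φ x 0 = φ0 x
  initial_velocity : ∀ᵐ x ∂(volume.restrict (Ioo 0 L)), φt x 0 = φ1 x

/-- The energy `𝓔_v(t)`, in terms of the derivatives `φx`, `φt` of the solution. -/
noncomputable def energy (L v : ℝ) (φx φt : ℝ → ℝ → ℝ) (t : ℝ) : ℝ :=
  1 / 2 * ∫ x in (v * t)..(L + v * t),
    ((φt x t + v * φx x t) ^ 2 + (1 - v ^ 2) * φx x t ^ 2)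

/-- The boundary value `φ_x(v t, t)`: the one-sided `x`-derivative at the left endpoint. -/
noncomputable def dxLeft (L v : ℝ) (φ : ℝ → ℝ → ℝ) (t : ℝ) : ℝ :=
  derivWithin (fun x => φ x t) (Icc (v * t) (L + v * t)) (v * t)

/-- The boundary value `φ_x(L + v t, t)`: the one-sided `x`-derivative at the right endpoint. -/
noncomputable def dxRight (L v : ℝ) (φ : ℝ → ℝ → ℝ) (t : ℝ) : ℝ :=
  derivWithin (fun x => φ x t) (Icc (v * t) (L + v * t)) (L + v * t)

end TravellingString

/-! The wave operator factors, so `φ_t + φ_x` is constant along `x + t = const` and `φ_t - φ_x`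
along `x - t = const`. Since `|v ± 1|` is finite, the moving intervals overlap at nearby times, and
the two quantities come from single profiles `f(x + t)` and `g(x - t)` with `f, g ∈ L²(ℝ)`
(`IsSolution.exists_characteristic_profile`). The Dirichlet conditions say that the primitives of
`f` and `g` agree at the arguments `(1 + v)t` and `(v - 1)t`, and likewise after adding `L` to both
(`IsSolution.primitive_eq_primitive` gives the left endpoint). Differentiation in `t` yields the
reflection law `(1 + v) f(a + (1 + v)t) = (v - 1) g(a + (v - 1)t)` for `a = 0, L`, hence `φ_x = (f -
g)/2 = f/(1 - v)` at both endpoints (`IsSolution.exists_boundary_profiles`).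

Everything is then a change of variables. At time zero `4𝓔 = (1 + v)∫₀ᴸ f² + (1 - v)∫₀ᴸ g²`. The
left trace over `[0, L/(1 + v)]` sweeps `f²` over `[0, L]`. The right trace over `[0, L/(1 - v)]`
sweeps `f²` beyond `L`, which by reflection is `g²` over `[0, L]`. The sum is the identity, and
observability follows by monotonicity in `T`. For the direct inequality, the reflection laws show
that any window of length `L` starting in `[0, (1 + v)T]` carries at most `4𝓔/(1 + v)` of `f²`, as
in conservation of energy; then the windows are counted. -/

namespace TravellingString

/-! ### Integration by parts and the lemma of du Bois-Reymond -/

/-- Integration by parts for a primitive against a `C¹` function. -/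
theorem integral_primitive_mul_deriv {a b : ℝ} {f ψ : ℝ → ℝ}
    (hf : IntervalIntegrable f volume a b) (hψ : ContDiff ℝ 1 ψ) :
    ∫ x in a..b, (∫ s in a..x, f s) * deriv ψ x =
      (∫ s in a..b, f s) * ψ b - ∫ x in a..b, f x * ψ x := by
  rw [(hf.absolutelyContinuousOnInterval_intervalIntegral
      left_mem_uIcc).integral_mul_deriv_eq_deriv_mul
      hψ.contDiffOn.absolutelyContinuousOnInterval]
  simp only [intervalIntegral.integral_same, zero_mul, sub_zero]
  congr 1
  refine intervalIntegral.integral_congr_ae ?_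
  filter_upwards [hf.ae_hasDerivAt_integral] with x hx hxm
  rw [(hx (uIoc_subset_uIcc hxm) a left_mem_uIcc).deriv]

theorem integrable_mul_of_tsupport_subset {a b : ℝ} {g K : ℝ → ℝ} (hg : Continuous g)
    (hs : tsupport g ⊆ Icc a b) (hK : ContinuousOn K (Icc a b)) :
    Integrable (fun t => g t * K t) := by
  have h1 : IntegrableOn (fun t => g t * K t) (Icc a b) :=
    (hg.continuousOn.mul hK).integrableOn_compact isCompact_Icc
  refine (integrableOn_iff_integrable_of_support_subset ?_).1 h1
  exact (Function.support_mul_subset_left g K).trans ((subset_tsupport g).trans hs)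

/-- A smooth function with compact support in `(a, b)` and integral zero is the derivative of
another such function. -/
theorem exists_deriv_eq_of_integral_eq_zero {a b : ℝ} {g : ℝ → ℝ} (hg : ContDiff ℝ ∞ g)
    (hc : HasCompactSupport g) (hs : tsupport g ⊆ Ioo a b) (h0 : ∫ t, g t = 0) :
    ∃ θ : ℝ → ℝ, ContDiff ℝ ∞ θ ∧ HasCompactSupport θ ∧ tsupport θ ⊆ Ioo a b ∧ deriv θ = g := by
  rcases eq_empty_or_nonempty (tsupport g) with he | hne
  · refine ⟨0, contDiff_const, HasCompactSupport.zero, by simp, ?_⟩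
    rw [tsupport_eq_empty_iff.1 he]
    ext t; simp
  obtain ⟨p₀, hp₀, hpl₀⟩ := hc.isCompact.exists_isLeast hne
  obtain ⟨q, hq, hqu⟩ := hc.isCompact.exists_isGreatest hne
  -- The base point lies strictly below the support, so that the support is contained in the
  -- half-open interval of integration `(p, t]` once `t > q`.
  obtain ⟨p, hap, hpp⟩ := exists_between (hs hp₀).1
  have hpl : ∀ t ∈ tsupport g, p < t := fun t ht => hpp.trans_le (hpl₀ ht)
  have hder : ∀ t, HasDerivAt (fun t => ∫ s in p..t, g s) (g t) t := fun t =>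
    intervalIntegral.integral_hasDerivAt_right (hg.continuous.intervalIntegrable _ _)
      hg.continuous.aestronglyMeasurable.stronglyMeasurableAtFilter hg.continuous.continuousAt
  have hd : deriv (fun t => ∫ s in p..t, g s) = g := funext fun t => (hder t).deriv
  have hz : ∀ t, t ∉ Icc p q → (∫ s in p..t, g s) = 0 := by
    intro t ht
    by_cases h1 : t < p
    · refine (intervalIntegral.integral_congr (g := fun _ => 0) ?_).trans (by simp)
      intro s hs'
      rw [uIcc_of_ge h1.le] at hs'
      exact image_eq_zero_of_notMem_tsupport fun h => (hpl s h).not_ge hs'.2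
    · have h2 : q < t := by
        by_contra h
        exact ht ⟨not_lt.1 h1, not_lt.1 h⟩
      rw [← h0]
      refine intervalIntegral.integral_eq_integral_of_support_subset ?_
      intro s hs'
      have := subset_tsupport g hs'
      exact ⟨hpl s this, (hqu this).trans h2.le⟩
  have hts : tsupport (fun t => ∫ s in p..t, g s) ⊆ Icc p q := by
    refine closure_minimal ?_ isClosed_Icc
    intro t ht
    by_contra h
    exact ht (hz t h)
  refine ⟨fun t => ∫ s in p..t, g s, ?_, ?_, ?_, hd⟩
  · rw [contDiff_infty_iff_deriv]
    exact ⟨fun t => (hder t).differentiableAt, by rw [hd]; exact hg⟩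
  · exact isCompact_Icc.of_isClosed_subset (isClosed_tsupport _) hts
  · refine hts.trans fun t ht => ⟨hap.trans_le ht.1, ht.2.trans_lt (hs hq).2⟩

/-- The lemma of du Bois-Reymond. -/
theorem eqOn_const_of_integral_deriv_mul_eq_zero {a b : ℝ} (hab : a < b) {K : ℝ → ℝ}
    (hK : ContinuousOn K (Icc a b))
    (h : ∀ θ : ℝ → ℝ, ContDiff ℝ ∞ θ → HasCompactSupport θ → tsupport θ ⊆ Ioo a b →
      ∫ t, deriv θ t * K t = 0) :
    ∃ c, ∀ t ∈ Icc a b, K t = c := by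
  let ρ₀ : ContDiffBump ((a + b) / 2) := ⟨(b - a) / 8, (b - a) / 4, by linarith, by linarith⟩
  set ρ : ℝ → ℝ := ρ₀.normed volume with hρ
  have hρc : ContDiff ℝ ∞ ρ := ρ₀.contDiff_normed
  have hρs : tsupport ρ ⊆ Ioo a b := by
    rw [hρ, ρ₀.tsupport_normed_eq, Real.closedBall_eq_Icc]
    intro t ht
    simp only [ρ₀, mem_Icc] at ht
    constructor <;> linarith [ht.1, ht.2]
  have hρk : HasCompactSupport ρ := ρ₀.hasCompactSupport_normed
  have hρi : ∫ t, ρ t = 1 := ρ₀.integral_normed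
  set c := ∫ t, ρ t * K t with hc
  refine ⟨c, ?_⟩
  have hae : ∀ᵐ t, t ∈ Ioo a b → K t - c = 0 := by
    refine isOpen_Ioo.ae_eq_zero_of_integral_contDiff_smul_eq_zero ?_ ?_
    · exact ContinuousOn.locallyIntegrableOn
        ((hK.mono Ioo_subset_Icc_self).sub continuousOn_const) measurableSet_Ioo
    · intro g hg hgk hgs
      set m := ∫ t, g t with hm
      have hgi : Integrable g := hg.continuous.integrable_of_hasCompactSupport hgk
      have hρi' : Integrable ρ := hρc.continuous.integrable_of_hasCompactSupport hρk
      have hgK := integrable_mul_of_tsupport_subset hg.continuous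
        (hgs.trans Ioo_subset_Icc_self) hK
      have hρK := integrable_mul_of_tsupport_subset hρc.continuous
        (hρs.trans Ioo_subset_Icc_self) hK
      -- Subtracting `m * ρ`, where `ρ` has integral one, gives mean zero and hence a derivative
      -- `θ'`. Testing with `θ` turns the hypothesis into `∫ g K = m c`.
      obtain ⟨θ, h1, h2, h3, h4⟩ := exists_deriv_eq_of_integral_eq_zero (a := a) (b := b)
        (g := fun t => g t - m * ρ t) (hg.sub (contDiff_const.mul hρc))
        (hgk.sub hρk.mul_left)
        ((tsupport_sub g _).trans (union_subset hgs ((tsupport_mul_subset_right).trans hρs)))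
        (by rw [integral_sub hgi (hρi'.const_mul m), integral_const_mul, hρi, ← hm]; ring)
      have h5 := h θ h1 h2 h3
      rw [h4] at h5
      have e1 : (fun t => (g t - m * ρ t) * K t) = fun t => g t * K t - m * (ρ t * K t) := by
        ext t; ring
      rw [e1, integral_sub hgK (hρK.const_mul m), integral_const_mul] at h5
      have e2 : (fun t => g t • (K t - c)) = fun t => g t * K t - g t * c := by
        ext t; simp only [smul_eq_mul]; ring
      rw [e2, integral_sub hgK (hgi.mul_const c), integral_mul_const]
      exact h5
  have := Measure.eqOn_Icc_of_ae_eq (X := ℝ) volume hab.ne (f := K) (g := fun _ => c) (by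
    rw [← restrict_Ioo_eq_restrict_Icc]
    refine (ae_restrict_iff' measurableSet_Ioo).2 ?_
    filter_upwards [hae] with t ht htm
    exact sub_eq_zero.1 (ht htm)) hK continuousOn_const
  exact this

/-! ### Pairings with travelling test functions -/

/-- The integral over `I_t` of `f(·, t)` against `A` transported with speed `-m`. -/
noncomputable def pairing (L v : ℝ) (f : ℝ → ℝ → ℝ) (A : ℝ → ℝ) (m t : ℝ) : ℝ :=
  ∫ x in (v * t)..(L + v * t), f x t * A (x + m * t)

theorem pairing_eq (L v : ℝ) (f : ℝ → ℝ → ℝ) (A : ℝ → ℝ) (m t : ℝ) :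
    pairing L v f A m t = ∫ y in (0 : ℝ)..L, f (y + v * t) t * A (y + (v + m) * t) := by
  have := intervalIntegral.integral_comp_add_right (a := 0) (b := L)
    (fun x => f x t * A (x + m * t)) (v * t)
  rw [zero_add] at this
  rw [pairing, ← this]
  refine intervalIntegral.integral_congr fun y _ => ?_
  congr 2
  ring

theorem isTestFunction_mul {L v S : ℝ} {θ A : ℝ → ℝ} {m : ℝ} (hθ : ContDiff ℝ ∞ θ)
    (hθc : HasCompactSupport θ) (hA : ContDiff ℝ ∞ A) (hAc : HasCompactSupport A)
    (h : ∀ t ∈ tsupport θ, ∀ u ∈ tsupport A, (u - m * t, t) ∈ domain L v S) :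
    IsTestFunction L v S (fun x t => θ t * A (x + m * t)) := by
  set K : Set (ℝ × ℝ) := (fun p : ℝ × ℝ => (p.1 - m * p.2, p.2)) '' (tsupport A ×ˢ tsupport θ)
  have hK : IsCompact K := (hAc.isCompact.prod hθc.isCompact).image (by fun_prop)
  have hsub : tsupport (fun p : ℝ × ℝ => θ p.2 * A (p.1 + m * p.2)) ⊆ K := by
    refine closure_minimal ?_ hK.isClosed
    intro p hp
    have h1 := left_ne_zero_of_mul hp
    have h2 := right_ne_zero_of_mul hp
    exact ⟨(p.1 + m * p.2, p.2), ⟨subset_tsupport A h2, subset_tsupport θ h1⟩, by simp⟩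
  refine ⟨?_, hK.of_isClosed_subset (isClosed_tsupport _) hsub, hsub.trans ?_⟩
  · exact (hθ.comp contDiff_snd).mul
      (hA.comp (contDiff_fst.add (contDiff_const.mul contDiff_snd)))
  · rintro _ ⟨p, ⟨hp1, hp2⟩, rfl⟩
    exact h _ hp2 _ hp1

theorem ContinuousInL2.integrableOn {L v S : ℝ} {f : ℝ → ℝ → ℝ} (hf : ContinuousInL2 L v S f)
    {t : ℝ} (ht : t ∈ Icc 0 S) : IntegrableOn (fun y => f (y + v * t) t) (Ioo 0 L) :=
  (hf.memLp t ht).integrable one_le_two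

theorem ContinuousInL2.intervalIntegrable {L v S : ℝ} (hL : 0 < L) {f : ℝ → ℝ → ℝ}
    (hf : ContinuousInL2 L v S f) {t : ℝ} (ht : t ∈ Icc 0 S) :
    IntervalIntegrable (fun x => f x t) volume (v * t) (L + v * t) := by
  have h : IntervalIntegrable (fun y => f (y + v * t) t) volume 0 L :=
    (intervalIntegrable_iff_integrableOn_Ioo_of_le hL.le).2 (hf.integrableOn ht)
  have := h.comp_add_right (-(v * t))
  simpa using this

theorem ContinuousInL2.intervalIntegrable_mul {L v S : ℝ} (hL : 0 < L) {f : ℝ → ℝ → ℝ}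
    (hf : ContinuousInL2 L v S f) {A : ℝ → ℝ} (hA : Continuous A) (m : ℝ) {t : ℝ}
    (ht : t ∈ Icc 0 S) :
    IntervalIntegrable (fun x => f x t * A (x + m * t)) volume (v * t) (L + v * t) :=
  (hf.intervalIntegrable hL ht).mul_continuousOn (by fun_prop)

/-- In the fixed frame the increment splits in two: the change of `f` is small in `L²`, hence in
`L¹` on a bounded interval, against the bounded `A`; the translation of `A` against the frozen `f(·,
t₀)` is handled by dominated convergence. -/
theorem ContinuousInL2.continuousOn_pairing {L v S : ℝ} (hL : 0 < L) {f : ℝ → ℝ → ℝ}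
    (hf : ContinuousInL2 L v S f) {A : ℝ → ℝ} (hA : Continuous A) (hAc : HasCompactSupport A)
    (m : ℝ) : ContinuousOn (pairing L v f A m) (Icc 0 S) := by
  obtain ⟨C, hC⟩ := hA.bounded_above_of_compact_support hAc
  have hC0 : 0 ≤ C := (norm_nonneg _).trans (hC 0)
  set μ := (volume : Measure ℝ).restrict (Ioo 0 L) with hμ
  have hpair : ∀ t, pairing L v f A m t = ∫ y, f (y + v * t) t * A (y + (v + m) * t) ∂μ := by
    intro t
    rw [pairing_eq, intervalIntegral.integral_of_le hL.le, hμ, restrict_Ioo_eq_restrict_Ioc]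
  have hint : ∀ t ∈ Icc 0 S, ∀ s,
      Integrable (fun y => f (y + v * t) t * A (y + (v + m) * s)) μ := fun t ht s =>
    (hf.integrableOn ht).mul_bdd (c := C) (by fun_prop) (ae_of_all _ fun y => hC _)
  intro t₀ ht₀
  have h1 : Tendsto (fun t => ∫ y, (f (y + v * t) t - f (y + v * t₀) t₀) *
      A (y + (v + m) * t) ∂μ) (𝓝[Icc 0 S] t₀) (𝓝 0) := by
    have := tendsto_integral_of_L1 (μ := μ) (fun _ => (0 : ℝ)) aestronglyMeasurable_const
      (F := fun t y => (f (y + v * t) t - f (y + v * t₀) t₀) * A (y + (v + m) * t))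
      (l := 𝓝[Icc 0 S] t₀) (by
        filter_upwards [self_mem_nhdsWithin] with t ht
        simp only [sub_mul]
        exact (hint t ht t).sub (hint t₀ ht₀ t)) (by
        have hlim : Tendsto (fun t => ENNReal.ofReal C *
            (eLpNorm (fun y => f (y + v * t) t - f (y + v * t₀) t₀) 2 μ *
              μ univ ^ (1 / (1 : ENNReal).toReal - 1 / (2 : ENNReal).toReal)))
            (𝓝[Icc 0 S] t₀) (𝓝 (ENNReal.ofReal C *
              (0 * μ univ ^ (1 / (1 : ENNReal).toReal - 1 / (2 : ENNReal).toReal)))) := by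
          refine ENNReal.Tendsto.const_mul (ENNReal.Tendsto.mul_const (hf.tendsto t₀ ht₀)
            (Or.inr ?_)) (Or.inr ENNReal.ofReal_ne_top)
          exact ENNReal.rpow_ne_top_of_nonneg (by norm_num) (measure_ne_top _ _)
        rw [zero_mul, mul_zero] at hlim
        refine tendsto_of_tendsto_of_tendsto_of_le_of_le' tendsto_const_nhds hlim
          (Eventually.of_forall fun _ => zero_le) ?_
        filter_upwards [self_mem_nhdsWithin] with t ht
        have hm : AEStronglyMeasurable (fun y => f (y + v * t) t - f (y + v * t₀) t₀) μ :=
          ((hf.memLp t ht).sub (hf.memLp t₀ ht₀)).aestronglyMeasurable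
        refine le_trans ?_ (mul_le_mul_right
          (eLpNorm_le_eLpNorm_mul_rpow_measure_univ one_le_two hm) _)
        rw [eLpNorm_one_eq_lintegral_enorm, ← lintegral_const_mul' _ _ ENNReal.ofReal_ne_top]
        refine lintegral_mono fun y => ?_
        simp only [sub_zero, enorm_mul]
        rw [mul_comm]
        gcongr
        rw [← ofReal_norm]
        exact ENNReal.ofReal_le_ofReal (hC _))
    simpa using this
  have h2 : Tendsto (fun t => ∫ y, f (y + v * t₀) t₀ * A (y + (v + m) * t) ∂μ)
      (𝓝[Icc 0 S] t₀) (𝓝 (∫ y, f (y + v * t₀) t₀ * A (y + (v + m) * t₀) ∂μ)) := by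
    refine tendsto_integral_filter_of_dominated_convergence
      (fun y => ‖f (y + v * t₀) t₀‖ * C) ?_ ?_ ((hf.integrableOn ht₀).norm.mul_const C) ?_
    · exact Eventually.of_forall fun t => (hint t₀ ht₀ t).aestronglyMeasurable
    · refine Eventually.of_forall fun t => ae_of_all _ fun y => ?_
      rw [norm_mul]
      exact mul_le_mul_of_nonneg_left (hC _) (norm_nonneg _)
    · refine ae_of_all _ fun y => Tendsto.const_mul _ (Tendsto.mono_left ?_ nhdsWithin_le_nhds)
      exact (by fun_prop : Continuous fun t => A (y + (v + m) * t)).tendsto t₀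
  have h3 := h1.add h2
  rw [zero_add] at h3
  rw [ContinuousWithinAt, hpair]
  refine h3.congr' ?_
  filter_upwards [self_mem_nhdsWithin] with t ht
  rw [hpair]
  simp only [sub_mul]
  rw [integral_sub (hint t ht t) (hint t₀ ht₀ t)]
  ring

theorem IsSolution.pairing_deriv {L v S : ℝ} (hL : 0 < L) {φ0 φ1 : ℝ → ℝ} {φ φx φt : ℝ → ℝ → ℝ}
    (hφ : IsSolution L v S φ0 φ1 φ φx φt) {A : ℝ → ℝ} (hA : ContDiff ℝ ∞ A) (m : ℝ) {t : ℝ}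
    (ht : t ∈ Icc 0 S) : pairing L v φ (deriv A) m t = - pairing L v φx A m t := by
  have hle : v * t ≤ L + v * t := by linarith
  have hH := hφ.memH10 t ht
  have h := integral_primitive_mul_deriv (ψ := fun x => A (x + m * t))
    (hφ.continuous_dx.intervalIntegrable hL ht)
    ((hA.of_le (by exact_mod_cast le_top)).comp (contDiff_id.add contDiff_const))
  rw [← hH.eq_integral _ (right_mem_Icc.2 hle), hH.right_eq_zero, zero_mul, zero_sub] at h
  rw [pairing, pairing, ← h]
  refine intervalIntegral.integral_congr fun x hx => ?_
  rw [uIcc_of_le hle] at hx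
  rw [hH.eq_integral x hx, deriv_comp_add_const]

theorem ContinuousInL2.add_const_mul {L v S : ℝ} {f g : ℝ → ℝ → ℝ} (hf : ContinuousInL2 L v S f)
    (hg : ContinuousInL2 L v S g) (k : ℝ) :
    ContinuousInL2 L v S (fun x t => f x t + k * g x t) := by
  refine ⟨fun t ht => (hf.memLp t ht).add ((hg.memLp t ht).const_mul k), fun t₀ ht₀ => ?_⟩
  have h := (hf.tendsto t₀ ht₀).add (ENNReal.Tendsto.const_mul (a := ‖k‖ₑ) (hg.tendsto t₀ ht₀)
    (Or.inr enorm_ne_top))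
  rw [mul_zero, add_zero] at h
  refine tendsto_of_tendsto_of_tendsto_of_le_of_le' tendsto_const_nhds h
    (Eventually.of_forall fun _ => zero_le) ?_
  filter_upwards [self_mem_nhdsWithin] with t ht
  have e : (fun y => f (y + v * t) t + k * g (y + v * t) t -
      (f (y + v * t₀) t₀ + k * g (y + v * t₀) t₀)) =
      (fun y => f (y + v * t) t - f (y + v * t₀) t₀) +
        k • (fun y => g (y + v * t) t - g (y + v * t₀) t₀) := by
    ext y
    simp only [Pi.add_apply, Pi.smul_apply, smul_eq_mul]
    ring
  have hgm := ((hg.memLp t ht).sub (hg.memLp t₀ ht₀)).aestronglyMeasurable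
  rw [e]
  refine (eLpNorm_add_le ((hf.memLp t ht).sub (hf.memLp t₀ ht₀)).aestronglyMeasurable
    (hgm.const_smul k) one_le_two).trans ?_
  rw [eLpNorm_const_smul]
  exact le_rfl

theorem pairing_add_const_mul {L v S : ℝ} (hL : 0 < L) {f g : ℝ → ℝ → ℝ}
    (hf : ContinuousInL2 L v S f) (hg : ContinuousInL2 L v S g) (k : ℝ) {A : ℝ → ℝ}
    (hA : Continuous A) (m : ℝ) {t : ℝ} (ht : t ∈ Icc 0 S) :
    pairing L v (fun x t => f x t + k * g x t) A m t =
      pairing L v f A m t + k * pairing L v g A m t := by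
  rw [pairing, pairing, pairing, ← intervalIntegral.integral_const_mul,
    ← intervalIntegral.integral_add (hf.intervalIntegrable_mul hL hA m ht)
      ((hg.intervalIntegrable_mul hL hA m ht).const_mul k)]
  refine intervalIntegral.integral_congr fun x _ => ?_
  ring

/-! ### Transport along characteristics -/

section

variable {L v S : ℝ} {φ0 φ1 : ℝ → ℝ} {φ φx φt : ℝ → ℝ → ℝ}

/-- This is the weak form of `d/dt ⟨φ, A(x + m t)⟩ = ⟨φ_t - m φ_x, A(x + m t)⟩`. The term with `m
A'` from the moving test function is integrated by parts in `x`, without boundary terms because `φ`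
vanishes at both ends. -/
theorem IsSolution.integral_deriv_mul_pairing (hL : 0 < L) (hS : 0 < S)
    (hφ : IsSolution L v S φ0 φ1 φ φx φt) {θ A : ℝ → ℝ} {m : ℝ} (hθ : ContDiff ℝ ∞ θ)
    (hθc : HasCompactSupport θ) (hA : ContDiff ℝ ∞ A) (hAc : HasCompactSupport A)
    (h : ∀ t ∈ tsupport θ, ∀ u ∈ tsupport A, (u - m * t, t) ∈ domain L v S) :
    ∫ t in (0 : ℝ)..S, deriv θ t * pairing L v φ A m t =
      - ∫ t in (0 : ℝ)..S, θ t * (pairing L v φt A m t - m * pairing L v φx A m t) := by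
  have hA' : ContDiff ℝ ∞ (deriv A) := (contDiff_infty_iff_deriv.1 hA).2
  have hw := hφ.weak_dt _ (isTestFunction_mul hθ hθc hA hAc h)
  have hcont := fun {f : ℝ → ℝ → ℝ} (hf : ContinuousInL2 L v S f) =>
    (hf.continuousOn_pairing hL hA.continuous hAc m)
  have hθ' : Continuous (deriv θ) := (contDiff_infty_iff_deriv.1 hθ).2.continuous
  have hii : ∀ {k K : ℝ → ℝ}, Continuous k → ContinuousOn K (Icc 0 S) →
      IntervalIntegrable (fun t => k t * K t) volume 0 S := fun hk hK =>
    ContinuousOn.intervalIntegrable (by rw [uIcc_of_le hS.le]; exact hk.continuousOn.mul hK)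
  have e1 : ∫ t in (0 : ℝ)..S, ∫ x in (v * t)..(L + v * t),
      φ x t * deriv (fun s => θ s * A (x + m * s)) t =
      ∫ t in (0 : ℝ)..S, (deriv θ t * pairing L v φ A m t -
        m * (θ t * pairing L v φx A m t)) := by
    refine intervalIntegral.integral_congr fun t ht => ?_
    rw [uIcc_of_le hS.le] at ht
    have e2 : ∀ x, φ x t * deriv (fun s => θ s * A (x + m * s)) t =
        deriv θ t * (φ x t * A (x + m * t)) +
          (m * θ t) * (φ x t * deriv A (x + m * t)) := by
      intro x
      have h1 : HasDerivAt (fun s => A (x + m * s)) (deriv A (x + m * t) * m) t := by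
        have h2 : HasDerivAt (fun s => x + m * s) m t := by
          simpa using ((hasDerivAt_id t).const_mul m).const_add x
        exact ((hA.differentiable (by simp)) _).hasDerivAt.comp t h2
      have h3 := ((hθ.differentiable (by simp)) t).hasDerivAt.mul h1
      have h4 : deriv (fun s => θ s * A (x + m * s)) t = _ := h3.deriv
      rw [h4]
      ring
    simp only [e2]
    rw [intervalIntegral.integral_add
      ((hφ.continuous_self.intervalIntegrable_mul hL hA.continuous m ht).const_mul _)
      ((hφ.continuous_self.intervalIntegrable_mul hL hA'.continuous m ht).const_mul _),
      intervalIntegral.integral_const_mul, intervalIntegral.integral_const_mul]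
    have := hφ.pairing_deriv hL hA m ht
    simp only [pairing] at this ⊢
    rw [this]
    ring
  have e3 : ∫ t in (0 : ℝ)..S, ∫ x in (v * t)..(L + v * t),
      φt x t * (θ t * A (x + m * t)) = ∫ t in (0 : ℝ)..S, θ t * pairing L v φt A m t := by
    refine intervalIntegral.integral_congr fun t _ => ?_
    simp only [pairing]
    rw [← intervalIntegral.integral_const_mul]
    refine intervalIntegral.integral_congr fun x _ => ?_
    ring
  rw [e1, e3, intervalIntegral.integral_sub (hii hθ' (hcont hφ.continuous_self))
    ((hii hθ.continuous (hcont hφ.continuous_dx)).const_mul m),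
    intervalIntegral.integral_const_mul] at hw
  have e4 : ∫ t in (0 : ℝ)..S, θ t * (pairing L v φt A m t - m * pairing L v φx A m t) =
      ∫ t in (0 : ℝ)..S, (θ t * pairing L v φt A m t - m * (θ t * pairing L v φx A m t)) := by
    refine intervalIntegral.integral_congr fun t _ => ?_
    ring
  rw [e4, intervalIntegral.integral_sub (hii hθ.continuous (hcont hφ.continuous_dt))
    ((hii hθ.continuous (hcont hφ.continuous_dx)).const_mul m),
    intervalIntegral.integral_const_mul]
  linarith

/-- `φ_t + σ φ_x` is transported along the characteristics `x + σ t = const`, tested form. -/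
theorem IsSolution.integral_deriv_mul_pairing_characteristic (hL : 0 < L) (hS : 0 < S)
    (hφ : IsSolution L v S φ0 φ1 φ φx φt) {θ A : ℝ → ℝ} {σ : ℝ} (hσ : σ ^ 2 = 1)
    (hθ : ContDiff ℝ ∞ θ)
    (hθc : HasCompactSupport θ) (hA : ContDiff ℝ ∞ A) (hAc : HasCompactSupport A)
    (h : ∀ t ∈ tsupport θ, ∀ u ∈ tsupport A, (u - σ * t, t) ∈ domain L v S) :
    ∫ t in (0 : ℝ)..S, deriv θ t * pairing L v (fun x t => φt x t + σ * φx x t) A σ t = 0 := by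
  have hA' : ContDiff ℝ ∞ (deriv A) := (contDiff_infty_iff_deriv.1 hA).2
  have hθ' : ContDiff ℝ ∞ (deriv θ) := (contDiff_infty_iff_deriv.1 hθ).2
  have hθ'' : ContDiff ℝ ∞ (deriv (deriv θ)) := (contDiff_infty_iff_deriv.1 hθ').2
  -- Applied with `θ'` as time factor, this trades the term with `θ''` in the wave equation for `θ'`
  -- against `φ_t - σ φ_x`.
  have hd := hφ.integral_deriv_mul_pairing hL hS hθ' hθc.deriv hA hAc
    (fun t ht u hu => h t (tsupport_deriv_subset ht) u hu)
  have hw := hφ.weak_wave _ (isTestFunction_mul hθ hθc hA hAc h)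
  have hcont := fun {f : ℝ → ℝ → ℝ} (hf : ContinuousInL2 L v S f) =>
    (hf.continuousOn_pairing hL hA.continuous hAc σ)
  have hii : ∀ {k K : ℝ → ℝ}, Continuous k → ContinuousOn K (Icc 0 S) →
      IntervalIntegrable (fun t => k t * K t) volume 0 S := fun hk hK =>
    ContinuousOn.intervalIntegrable (by rw [uIcc_of_le hS.le]; exact hk.continuousOn.mul hK)
  have e1 : ∫ t in (0 : ℝ)..S, ∫ x in (v * t)..(L + v * t),
      φ x t * (iteratedDeriv 2 (fun s => θ s * A (x + σ * s)) t -
        iteratedDeriv 2 (fun y => θ t * A (y + σ * t)) x) =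
      ∫ t in (0 : ℝ)..S, (deriv (deriv θ) t * pairing L v φ A σ t -
        2 * σ * (deriv θ t * pairing L v φx A σ t)) := by
    refine intervalIntegral.integral_congr fun t ht => ?_
    rw [uIcc_of_le hS.le] at ht
    -- The two terms with `A''` cancel because `σ² = 1`; only `θ'' A + 2σ θ' A'` remains.
    have e2 : ∀ x, φ x t * (iteratedDeriv 2 (fun s => θ s * A (x + σ * s)) t -
        iteratedDeriv 2 (fun y => θ t * A (y + σ * t)) x) =
        deriv (deriv θ) t * (φ x t * A (x + σ * t)) +
          (2 * σ * deriv θ t) * (φ x t * deriv A (x + σ * t)) := by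
      intro x
      have h2 : ∀ s, HasDerivAt (fun s => x + σ * s) σ s := fun s => by
        simpa using ((hasDerivAt_id s).const_mul σ).const_add x
      have hB : ∀ {B : ℝ → ℝ}, ContDiff ℝ ∞ B → ∀ s,
          HasDerivAt (fun s => B (x + σ * s)) (deriv B (x + σ * s) * σ) s := fun {B} hB s =>
        ((hB.differentiable (by simp)) _).hasDerivAt.comp s (h2 s)
      have hk : ∀ {k : ℝ → ℝ}, ContDiff ℝ ∞ k → ∀ s, HasDerivAt k (deriv k s) s := fun {k} hk s =>
        ((hk.differentiable (by simp)) s).hasDerivAt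
      have d1 : deriv (fun s => θ s * A (x + σ * s)) = fun s =>
          deriv θ s * A (x + σ * s) + θ s * (deriv A (x + σ * s) * σ) :=
        funext fun s => ((hk hθ s).mul (hB hA s)).deriv
      have d2 : deriv (deriv (fun s => θ s * A (x + σ * s))) t =
          (deriv (deriv θ) t * A (x + σ * t) + deriv θ t * (deriv A (x + σ * t) * σ)) +
          (deriv θ t * (deriv A (x + σ * t) * σ) +
            θ t * (deriv (deriv A) (x + σ * t) * σ * σ)) := by
        rw [d1]
        exact (((hk hθ' t).mul (hB hA t)).add
          ((hk hθ t).mul ((hB hA' t).mul_const σ))).deriv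
      have hC : ∀ {B : ℝ → ℝ}, ContDiff ℝ ∞ B → ∀ y,
          HasDerivAt (fun y => θ t * B (y + σ * t)) (θ t * deriv B (y + σ * t)) y := fun {B} hB y =>
        ((hk hB _).comp_add_const y (σ * t)).const_mul (θ t)
      have d3 : deriv (fun y => θ t * A (y + σ * t)) = fun y => θ t * deriv A (y + σ * t) :=
        funext fun y => (hC hA y).deriv
      have d4 : deriv (deriv (fun y => θ t * A (y + σ * t))) x =
          θ t * deriv (deriv A) (x + σ * t) := by
        rw [d3]
        exact (hC hA' x).deriv
      rw [iteratedDeriv_succ, iteratedDeriv_one, iteratedDeriv_succ, iteratedDeriv_one, d2, d4]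
      linear_combination φ x t * θ t * deriv (deriv A) (x + σ * t) * hσ
    simp only [e2]
    rw [intervalIntegral.integral_add
      ((hφ.continuous_self.intervalIntegrable_mul hL hA.continuous σ ht).const_mul _)
      ((hφ.continuous_self.intervalIntegrable_mul hL hA'.continuous σ ht).const_mul _),
      intervalIntegral.integral_const_mul, intervalIntegral.integral_const_mul]
    have := hφ.pairing_deriv hL hA σ ht
    simp only [pairing] at this ⊢
    rw [this]
    ring
  rw [e1, intervalIntegral.integral_sub (hii hθ''.continuous (hcont hφ.continuous_self))
    ((hii hθ'.continuous (hcont hφ.continuous_dx)).const_mul _),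
    intervalIntegral.integral_const_mul, hd] at hw
  have e4 : ∀ k : ℝ, ∫ t in (0 : ℝ)..S,
      deriv θ t * (pairing L v φt A σ t + k * pairing L v φx A σ t) =
      (∫ t in (0 : ℝ)..S, deriv θ t * pairing L v φt A σ t) +
        k * ∫ t in (0 : ℝ)..S, deriv θ t * pairing L v φx A σ t := by
    intro k
    rw [← intervalIntegral.integral_const_mul,
      ← intervalIntegral.integral_add (hii hθ'.continuous (hcont hφ.continuous_dt))
      ((hii hθ'.continuous (hcont hφ.continuous_dx)).const_mul _)]
    refine intervalIntegral.integral_congr fun t _ => ?_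
    ring
  have e5 : ∫ t in (0 : ℝ)..S, deriv θ t * pairing L v (fun x t => φt x t + σ * φx x t) A σ t =
      ∫ t in (0 : ℝ)..S, deriv θ t * (pairing L v φt A σ t + σ * pairing L v φx A σ t) := by
    refine intervalIntegral.integral_congr fun t ht => ?_
    rw [uIcc_of_le hS.le] at ht
    rw [pairing_add_const_mul hL hφ.continuous_dt hφ.continuous_dx σ hA.continuous σ ht]
  have e6 := e4 (-σ)
  simp only [neg_mul, ← sub_eq_add_neg] at e6
  rw [e6] at hw
  rw [e5, e4]
  linarith

theorem pairing_eq_integral {f : ℝ → ℝ → ℝ} {A : ℝ → ℝ} {m t : ℝ}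
    (h : tsupport A ⊆ Ioo ((v + m) * t) (L + (v + m) * t)) :
    pairing L v f A m t = ∫ z, A z * f (z - m * t) t := by
  have h1 := intervalIntegral.integral_comp_add_right (a := v * t) (b := L + v * t)
    (fun z => f (z - m * t) t * A z) (m * t)
  simp only [add_sub_cancel_right] at h1
  rw [pairing, h1]
  have h2 : ∀ z, A z * f (z - m * t) t = f (z - m * t) t * A z := fun z => mul_comm _ _
  simp only [h2]
  refine intervalIntegral.integral_eq_integral_of_support_subset ?_
  intro z hz
  have := h (subset_tsupport A (right_ne_zero_of_mul hz))
  exact ⟨by linarith [this.1], by linarith [this.2]⟩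

/-- `φ_t + σ φ_x` is transported along the characteristics `x + σ t = const`. -/
theorem IsSolution.ae_eq_of_characteristic (hL : 0 < L) (hS : 0 < S)
    (hφ : IsSolution L v S φ0 φ1 φ φx φt) {σ : ℝ} (hσ : σ ^ 2 = 1) {t₁ t₂ a b : ℝ}
    (h₁ : 0 ≤ t₁) (h₁₂ : t₁ ≤ t₂) (h₂ : t₂ ≤ S)
    (hab₁ : Ioo a b ⊆ Ioo ((v + σ) * t₁) (L + (v + σ) * t₁))
    (hab₂ : Ioo a b ⊆ Ioo ((v + σ) * t₂) (L + (v + σ) * t₂)) :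
    ∀ᵐ z, z ∈ Ioo a b → φt (z - σ * t₁) t₁ + σ * φx (z - σ * t₁) t₁ =
      φt (z - σ * t₂) t₂ + σ * φx (z - σ * t₂) t₂ := by
  rcases h₁₂.eq_or_lt with rfl | hlt
  · exact ae_of_all _ fun _ _ => rfl
  set r : ℝ → ℝ → ℝ := fun x t => φt x t + σ * φx x t with hr
  have hrc : ContinuousInL2 L v S r := hφ.continuous_dt.add_const_mul hφ.continuous_dx σ
  have hm₁ : t₁ ∈ Icc 0 S := ⟨h₁, h₁₂.trans h₂⟩
  have hm₂ : t₂ ∈ Icc 0 S := ⟨h₁.trans h₁₂, h₂⟩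
  have hint : ∀ t ∈ Icc 0 S, Ioo a b ⊆ Ioo ((v + σ) * t) (L + (v + σ) * t) →
      IntegrableOn (fun z => r (z - σ * t) t) (Ioo a b) := by
    intro t ht hs
    have := (hrc.intervalIntegrable hL ht).comp_sub_right (σ * t)
    rw [intervalIntegrable_iff_integrableOn_Ioo_of_le (by linarith)] at this
    refine this.mono_set (hs.trans ?_)
    intro z hz
    exact ⟨by linarith [hz.1], by linarith [hz.2]⟩
  have i₁ := hint t₁ hm₁ hab₁
  have i₂ := hint t₂ hm₂ hab₂
  have key := isOpen_Ioo.ae_eq_zero_of_integral_contDiff_smul_eq_zero (U := Ioo a b)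
    (f := fun z => r (z - σ * t₁) t₁ - r (z - σ * t₂) t₂) (μ := volume)
    (i₁.sub i₂).locallyIntegrableOn ?_
  · filter_upwards [key] with z hz hzm
    exact sub_eq_zero.1 (hz hzm)
  intro A hA hAc hAs
  have hK : ContinuousOn (pairing L v r A σ) (Icc t₁ t₂) :=
    (hrc.continuousOn_pairing hL hA.continuous hAc σ).mono (Icc_subset_Icc h₁ h₂)
  obtain ⟨c, hc⟩ := eqOn_const_of_integral_deriv_mul_eq_zero hlt hK (by
    intro θ hθ hθc hθs
    rw [← hφ.integral_deriv_mul_pairing_characteristic hL hS hσ hθ hθc hA hAc]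
    · symm
      refine intervalIntegral.integral_eq_integral_of_support_subset ?_
      intro t ht
      have := hθs (tsupport_deriv_subset (subset_tsupport _ (left_ne_zero_of_mul ht)))
      exact ⟨by linarith [this.1], by linarith [this.2]⟩
    · intro t ht u hu
      have ht' := hθs ht
      have hu₁ := hab₁ (hAs hu)
      have hu₂ := hab₂ (hAs hu)
      refine ⟨⟨by linarith [ht'.1], by linarith [ht'.2]⟩, ?_⟩
      simp only [mem_Ioo] at hu₁ hu₂ ht' ⊢
      -- The interval moves monotonically in time, so lying inside it at `t₁` and `t₂` implies lying
      -- inside it in between.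
      rcases le_total 0 (v + σ) with hs | hs
      · constructor <;> nlinarith
      · constructor <;> nlinarith)
  have hK₁ := hc t₁ (left_mem_Icc.2 h₁₂)
  have hK₂ := hc t₂ (right_mem_Icc.2 h₁₂)
  rw [pairing_eq_integral (hAs.trans hab₁)] at hK₁
  rw [pairing_eq_integral (hAs.trans hab₂)] at hK₂
  have hAi : ∀ {k : ℝ → ℝ}, IntegrableOn k (Ioo a b) → Integrable (fun z => A z * k z) := by
    intro k hk
    obtain ⟨C, hC⟩ := hA.continuous.bounded_above_of_compact_support hAc
    refine (integrableOn_iff_integrable_of_support_subset (s := Ioo a b)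
      ((Function.support_mul_subset_left _ _).trans ((subset_tsupport A).trans hAs))).1 ?_
    exact hk.bdd_mul (c := C) hA.continuous.aestronglyMeasurable (ae_of_all _ hC)
  simp only [smul_eq_mul, mul_sub]
  rw [integral_sub (hAi i₁) (hAi i₂), hK₁, hK₂, sub_self]

end

/-! ### Global profiles and d'Alembert's representation -/

theorem intervalIntegrable_of_memLp_two {k : ℝ → ℝ} (hk : MemLp k 2 volume) (a b : ℝ) :
    IntervalIntegrable k volume a b :=
  intervalIntegrable_iff.2 (((hk.locallyIntegrable one_le_two).integrableOn_isCompact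
    isCompact_uIcc).mono_set uIoc_subset_uIcc)

/-- A family of `L²` functions on the moving intervals `(c t, L + c t)` which agree on overlaps
comes from one `L²` function on the line. -/
theorem exists_memLp_of_ae_eq_overlap {L S c : ℝ} (hL : 0 < L) (hS : 0 < S) {R : ℝ → ℝ → ℝ}
    (hm : ∀ t ∈ Icc 0 S, MemLp (R t) 2 (volume.restrict (Ioo (c * t) (L + c * t))))
    (hR : ∀ t₁ t₂ a b, 0 ≤ t₁ → t₁ ≤ t₂ → t₂ ≤ S → Ioo a b ⊆ Ioo (c * t₁) (L + c * t₁) →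
      Ioo a b ⊆ Ioo (c * t₂) (L + c * t₂) → ∀ᵐ z, z ∈ Ioo a b → R t₁ z = R t₂ z) :
    ∃ f : ℝ → ℝ, MemLp f 2 volume ∧
      ∀ t ∈ Icc 0 S, ∀ᵐ z, z ∈ Ioo (c * t) (L + c * t) → R t z = f z := by
  -- A time step short enough that the interval moves by less than its length, so that successive
  -- intervals overlap.
  set δ := L / (2 * (|c| + 1)) with hδ
  have hc0 := abs_nonneg c
  have hδ0 : 0 < δ := by positivity
  have hcδ : |c| * δ < L := by
    rw [hδ, ← mul_div_assoc, div_lt_iff₀ (by positivity)]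
    nlinarith
  have hR' : ∀ t₁ t₂, 0 ≤ t₁ → t₁ ≤ t₂ → t₂ ≤ S → ∀ᵐ z, z ∈ Ioo (c * t₁) (L + c * t₁) →
      z ∈ Ioo (c * t₂) (L + c * t₂) → R t₁ z = R t₂ z := by
    intro t₁ t₂ h1 h12 h2
    filter_upwards [hR t₁ t₂ (max (c * t₁) (c * t₂)) (min (L + c * t₁) (L + c * t₂)) h1 h12 h2
      (Ioo_subset_Ioo (le_max_left _ _) (min_le_left _ _))
      (Ioo_subset_Ioo (le_max_right _ _) (min_le_right _ _))] with z hz hz1 hz2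
    exact hz ⟨max_lt hz1.1 hz2.1, lt_min hz1.2 hz2.2⟩
  have step : ∀ n : ℕ, ∃ f : ℝ → ℝ, MemLp f 2 volume ∧
      ∀ t ∈ Icc 0 (min (n * δ) S), ∀ᵐ z, z ∈ Ioo (c * t) (L + c * t) → R t z = f z := by
    intro n
    induction n with
    | zero =>
      refine ⟨(Ioo (c * 0) (L + c * 0)).indicator (R 0),
        (memLp_indicator_iff_restrict measurableSet_Ioo).2 (hm 0 ⟨le_rfl, hS.le⟩), ?_⟩
      intro t ht
      have ht0 : t = 0 := by
        have := ht.2.trans (min_le_left _ _)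
        simp only [Nat.cast_zero, zero_mul] at this
        exact le_antisymm this ht.1
      subst ht0
      exact ae_of_all _ fun z hz => (indicator_of_mem hz _).symm
    | succ n ih =>
      obtain ⟨f, hf, hfR⟩ := ih
      set s := min (n * δ) S with hs
      set s' := min ((n + 1 : ℕ) * δ) S with hs'
      have hs0 : 0 ≤ s := le_min (by positivity) hS.le
      have hsS : s ≤ S := min_le_right _ _
      have hsS' : s' ≤ S := min_le_right _ _
      have hss' : s ≤ s' := min_le_min_right _ (by push_cast; nlinarith)
      have hsd : s' ≤ s + δ := by
        rw [hs, ← min_add_add_right]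
        refine min_le_min ?_ (by linarith)
        push_cast
        linarith
      set E := Ioo (c * s') (L + c * s') with hE
      -- The profile is overwritten on the newest interval `E` and kept elsewhere.
      refine ⟨E.indicator (R s') + Eᶜ.indicator f, ?_, ?_⟩
      · exact ((memLp_indicator_iff_restrict measurableSet_Ioo).2
          (hm s' ⟨hs0.trans hss', hsS'⟩)).add (hf.indicator measurableSet_Ioo.compl)
      intro t ht
      have hold : ∀ᵐ z, z ∈ Ioo (c * t) (L + c * t) → z ∉ E → R t z = f z := by
        rcases le_total t s with hts | hts
        · filter_upwards [hfR t ⟨ht.1, hts⟩] with z hz hz1 _ using hz hz1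
        · filter_upwards [hfR s ⟨hs0, le_rfl⟩, hR' s t hs0 hts (ht.2.trans hsS')] with z h1 h2 hzt hzE
          -- A point of the intermediate interval outside `E` has been left behind by the motion. As
          -- the intervals at times `s` and `s'` overlap, no gap separates it from the interval at
          -- time `s`.
          have hzs : z ∈ Ioo (c * s) (L + c * s) := by
            have hb : |c| * (s' - s) < L :=
              (mul_le_mul_of_nonneg_left (by linarith) hc0).trans_lt hcδ
            rcases le_total 0 c with h0 | h0
            · rw [abs_of_nonneg h0] at hb
              have e1 : c * s ≤ c * t := mul_le_mul_of_nonneg_left hts h0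
              have e2 : c * t ≤ c * s' := mul_le_mul_of_nonneg_left ht.2 h0
              refine ⟨e1.trans_lt hzt.1, ?_⟩
              by_contra hcon
              exact hzE ⟨by linarith, by linarith [hzt.2]⟩
            · rw [abs_of_nonpos h0] at hb
              have e1 : c * t ≤ c * s := mul_le_mul_of_nonpos_left hts h0
              have e2 : c * s' ≤ c * t := mul_le_mul_of_nonpos_left ht.2 h0
              refine ⟨?_, by linarith [hzt.2]⟩
              by_contra hcon
              exact hzE ⟨by linarith [hzt.1], by linarith⟩
          rw [← h2 hzs hzt, h1 hzs]
      filter_upwards [hold, hR' t s' ht.1 ht.2 hsS'] with z h1 h2 hz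
      by_cases hzE : z ∈ E
      · simp [hzE, h2 hz hzE]
      · simp [hzE, h1 hz hzE]
  obtain ⟨n, hn⟩ := exists_nat_gt (S / δ)
  obtain ⟨f, hf, h⟩ := step n
  refine ⟨f, hf, fun t ht => h t ?_⟩
  rw [min_eq_right ((div_lt_iff₀ hδ0).1 hn).le]
  exact ht

section

variable {L v S : ℝ} {φ0 φ1 : ℝ → ℝ} {φ φx φt : ℝ → ℝ → ℝ}

theorem IsSolution.exists_characteristic_profile (hL : 0 < L) (hS : 0 < S)
    (hφ : IsSolution L v S φ0 φ1 φ φx φt) {σ : ℝ} (hσ : σ ^ 2 = 1) :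
    ∃ f : ℝ → ℝ, MemLp f 2 volume ∧ ∀ t ∈ Icc 0 S, ∀ᵐ x, x ∈ Ioo (v * t) (L + v * t) →
      φt x t + σ * φx x t = f (x + σ * t) := by
  obtain ⟨f, hf, h⟩ := exists_memLp_of_ae_eq_overlap (c := v + σ) hL hS
    (R := fun t z => φt (z - σ * t) t + σ * φx (z - σ * t) t) (by
      intro t ht
      have h1 := (hφ.continuous_dt.add_const_mul hφ.continuous_dx σ).memLp t ht
      have h2 := h1.comp_measurePreserving
        ((measurePreserving_sub_right volume ((v + σ) * t)).restrict_preimage measurableSet_Ioo)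
      rw [preimage_sub_const_Ioo, zero_add] at h2
      convert h2 using 2 with z
      simp only [Function.comp_apply]
      congr 3 <;> ring)
    (fun t₁ t₂ a b h₁ h₁₂ h₂ hab₁ hab₂ =>
      hφ.ae_eq_of_characteristic hL hS hσ h₁ h₁₂ h₂ hab₁ hab₂)
  refine ⟨f, hf, fun t ht => ?_⟩
  have := (measurePreserving_add_right volume (σ * t)).quasiMeasurePreserving.ae (h t ht)
  filter_upwards [this] with x hx hxm
  have := hx ⟨by linarith [hxm.1], by linarith [hxm.2]⟩
  simpa using this

/-- D'Alembert's representation, up to a function of time. -/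
theorem IsSolution.exists_dAlembert (hL : 0 < L) (hS : 0 < S)
    (hφ : IsSolution L v S φ0 φ1 φ φx φt) :
    ∃ f g : ℝ → ℝ, MemLp f 2 volume ∧ MemLp g 2 volume ∧ ∀ t ∈ Icc 0 S,
      (∀ᵐ x, x ∈ Ioo (v * t) (L + v * t) →
        φx x t = (f (x + t) - g (x - t)) / 2 ∧ φt x t = (f (x + t) + g (x - t)) / 2) ∧
      ∀ x ∈ Icc (v * t) (L + v * t), φ x t =
        ((∫ z in (v * t + t)..(x + t), f z) - ∫ z in (v * t - t)..(x - t), g z) / 2 := by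
  obtain ⟨f, hf, hfe⟩ := hφ.exists_characteristic_profile hL hS (σ := 1) (by norm_num)
  obtain ⟨g, hg, hge⟩ := hφ.exists_characteristic_profile hL hS (σ := -1) (by norm_num)
  refine ⟨f, g, hf, hg, fun t ht => ?_⟩
  have hae : ∀ᵐ x, x ∈ Ioo (v * t) (L + v * t) →
      φx x t = (f (x + t) - g (x - t)) / 2 ∧ φt x t = (f (x + t) + g (x - t)) / 2 := by
    filter_upwards [hfe t ht, hge t ht] with x h1 h2 hx
    have h1 := h1 hx
    have h2 := h2 hx
    simp only [one_mul, neg_mul, ← sub_eq_add_neg] at h1 h2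
    constructor <;> linarith
  refine ⟨hae, fun x hx => ?_⟩
  rw [(hφ.memH10 t ht).eq_integral x hx]
  have e : ∫ s in (v * t)..x, φx s t = ∫ s in (v * t)..x, (f (s + t) - g (s - t)) / 2 := by
    refine intervalIntegral.integral_congr_ae ?_
    -- The half-open `uIoc` may contain the right endpoint, where nothing is known about `φx`.
    have hne : ∀ᵐ s : ℝ, s ≠ L + v * t := by simp [ae_iff]
    filter_upwards [hae, hne] with s hs hsn hsm
    rw [uIoc_of_le hx.1] at hsm
    exact (hs ⟨hsm.1, lt_of_le_of_ne (hsm.2.trans hx.2) hsn⟩).1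
  rw [e, intervalIntegral.integral_div, intervalIntegral.integral_sub,
    intervalIntegral.integral_comp_add_right, intervalIntegral.integral_comp_sub_right]
  · simpa using (intervalIntegrable_of_memLp_two hf (v * t + t) (x + t)).comp_add_right t
  · simpa using (intervalIntegrable_of_memLp_two hg (v * t - t) (x - t)).comp_sub_right t

end

/-! ### The boundary condition in terms of the primitives -/

theorem continuous_primitive_of_memLp_two {k : ℝ → ℝ} (hk : MemLp k 2 volume) (a : ℝ) :
    Continuous fun x => ∫ z in a..x, k z :=
  intervalIntegral.continuous_primitive (intervalIntegrable_of_memLp_two hk) a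

theorem integral_primitive_mul_deriv_of_hasCompactSupport {k ψ : ℝ → ℝ} (hk : MemLp k 2 volume)
    (hψ : ContDiff ℝ ∞ ψ) (hψc : HasCompactSupport ψ) :
    ∫ y, (∫ z in (0 : ℝ)..y, k z) * deriv ψ y = - ∫ y, k y * ψ y := by
  obtain ⟨r, hr⟩ := hψc.isCompact.isBounded.subset_ball 0
  rw [Real.ball_eq_Ioo, zero_sub, zero_add] at hr
  have hi := intervalIntegrable_of_memLp_two hk
  have hψ1 : ContDiff ℝ 1 ψ := hψ.of_le (by exact_mod_cast le_top)
  have hψ' : Continuous (deriv ψ) := (contDiff_infty_iff_deriv.1 hψ).2.continuous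
  have hz : ∀ y, y ∉ Ioo (-r) r → ψ y = 0 := fun y hy =>
    image_eq_zero_of_notMem_tsupport fun h => hy (hr h)
  have hr1 : ψ r = 0 := hz _ (by simp)
  have hr2 : ψ (-r) = 0 := hz _ (by simp)
  have h := integral_primitive_mul_deriv (hi (-r) r) hψ1
  rw [hr1, mul_zero, zero_sub] at h
  have h0 : ∫ y in (-r)..r, deriv ψ y = 0 := by
    rw [intervalIntegral.integral_deriv_eq_sub
      (fun y _ => (hψ.differentiable (by simp)) y) (hψ'.intervalIntegrable _ _), hr1, hr2, sub_zero]
  have e1 : ∫ y, (∫ z in (0 : ℝ)..y, k z) * deriv ψ y =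
      ∫ y in (-r)..r, (∫ z in (0 : ℝ)..y, k z) * deriv ψ y := by
    refine (intervalIntegral.integral_eq_integral_of_support_subset ?_).symm
    intro y hy
    exact Ioo_subset_Ioc_self (hr (tsupport_deriv_subset (subset_tsupport _
      (right_ne_zero_of_mul hy))))
  have e2 : ∫ y, k y * ψ y = ∫ y in (-r)..r, k y * ψ y := by
    refine (intervalIntegral.integral_eq_integral_of_support_subset ?_).symm
    intro y hy
    exact Ioo_subset_Ioc_self (hr (subset_tsupport _ (right_ne_zero_of_mul hy)))
  -- Moving the base point of the primitive adds a constant, which is invisible because `∫ ψ' = 0`.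
  have e3 : ∫ y in (-r)..r, (∫ z in (0 : ℝ)..y, k z) * deriv ψ y =
      ∫ y in (-r)..r, ((∫ z in (-r)..y, k z) * deriv ψ y +
        (∫ z in (0 : ℝ)..(-r), k z) * deriv ψ y) := by
    refine intervalIntegral.integral_congr fun y _ => ?_
    rw [← intervalIntegral.integral_add_adjacent_intervals (hi 0 (-r)) (hi (-r) y)]
    ring
  rw [e1, e2, e3, intervalIntegral.integral_add, h, intervalIntegral.integral_const_mul, h0]
  · ring
  · exact ((continuous_primitive_of_memLp_two hk _).mul hψ').intervalIntegrable _ _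
  · exact (hψ'.const_mul _).intervalIntegrable _ _

/-- The integral is the convolution of the primitive with `ψ(-·)` at `c t`, so the derivative can
fall on the smooth factor; integration by parts then returns it to the primitive and produces `k`.
-/
theorem hasDerivAt_integral_primitive_mul {k ψ : ℝ → ℝ} (hk : MemLp k 2 volume)
    (hψ : ContDiff ℝ ∞ ψ) (hψc : HasCompactSupport ψ) (c t : ℝ) :
    HasDerivAt (fun t => ∫ y, (∫ z in (0 : ℝ)..(y + c * t), k z) * ψ y)
      (c * ∫ y, k (y + c * t) * ψ y) t := by
  set F : ℝ → ℝ := fun y => ∫ z in (0 : ℝ)..y, k z with hF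
  have hFc : Continuous F := continuous_primitive_of_memLp_two hk 0
  have hn : ContDiff ℝ ∞ fun x => ψ (-x) := hψ.comp contDiff_neg
  have hnc : HasCompactSupport fun x => ψ (-x) :=
    hψc.comp_homeomorph (Homeomorph.neg ℝ)
  have h1 := hnc.hasDerivAt_convolution_right (ContinuousLinearMap.mul ℝ ℝ) (μ := volume)
    hFc.locallyIntegrable (hn.of_le (by exact_mod_cast le_top)) (c * t)
  have hconv : ∀ s, convolution F (fun x => ψ (-x)) (ContinuousLinearMap.mul ℝ ℝ) volume s =
      ∫ y, F (y + s) * ψ y := by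
    intro s
    rw [convolution, ← integral_add_right_eq_self _ s]
    simp
  have hder : convolution F (deriv fun x => ψ (-x)) (ContinuousLinearMap.mul ℝ ℝ) volume (c * t) =
      ∫ y, k (y + c * t) * ψ y := by
    have hp := integral_primitive_mul_deriv_of_hasCompactSupport hk
      (ψ := fun y => ψ (y - c * t)) (hψ.comp (contDiff_id.sub contDiff_const))
      (hψc.comp_homeomorph (Homeomorph.subRight (c * t)))
    rw [← integral_add_right_eq_self (fun y => k y * ψ (y - c * t)) (c * t)] at hp
    simp only [add_sub_cancel_right] at hp
    rw [← neg_eq_iff_eq_neg] at hp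
    rw [← hp, convolution, ← integral_neg]
    refine integral_congr_ae (ae_of_all _ fun y => ?_)
    simp only [ContinuousLinearMap.mul_apply', deriv_comp_neg, deriv_comp_sub_const, neg_sub,
      mul_neg, hF]
  rw [hder] at h1
  have h2 : HasDerivAt (fun s => c * s) c t := by simpa using (hasDerivAt_id t).const_mul c
  have h3 := h1.comp t h2
  rw [mul_comm]
  refine h3.congr_of_eventuallyEq (Eventually.of_forall fun s => ?_)
  simp only [Function.comp_apply, hconv]
  rfl

section

variable {L v S : ℝ} {φ0 φ1 : ℝ → ℝ} {φ φx φt : ℝ → ℝ → ℝ}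

/-- The homogeneous boundary condition at the left endpoint, in terms of the two profiles. -/
theorem IsSolution.primitive_eq_primitive (hL : 0 < L) (hS : 0 < S)
    (hφ : IsSolution L v S φ0 φ1 φ φx φt) {f g : ℝ → ℝ} (hf : MemLp f 2 volume)
    (hg : MemLp g 2 volume)
    (hd : ∀ t ∈ Icc 0 S, ∀ᵐ x, x ∈ Ioo (v * t) (L + v * t) →
        φx x t = (f (x + t) - g (x - t)) / 2 ∧ φt x t = (f (x + t) + g (x - t)) / 2)
    (hrep : ∀ t ∈ Icc 0 S, ∀ x ∈ Icc (v * t) (L + v * t), φ x t =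
        ((∫ z in (v * t + t)..(x + t), f z) - ∫ z in (v * t - t)..(x - t), g z) / 2)
    {t : ℝ} (ht : t ∈ Icc 0 S) :
    ∫ z in (0 : ℝ)..((v + 1) * t), f z = ∫ z in (0 : ℝ)..((v - 1) * t), g z := by
  set F : ℝ → ℝ := fun x => ∫ z in (0 : ℝ)..x, f z with hF
  set G : ℝ → ℝ := fun x => ∫ z in (0 : ℝ)..x, g z with hG
  have hfi := intervalIntegrable_of_memLp_two hf
  have hgi := intervalIntegrable_of_memLp_two hg
  have hFc : Continuous F := continuous_primitive_of_memLp_two hf 0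
  have hGc : Continuous G := continuous_primitive_of_memLp_two hg 0
  let ρ₀ : ContDiffBump (L / 2) := ⟨L / 8, L / 4, by linarith, by linarith⟩
  set ψ : ℝ → ℝ := ρ₀.normed volume with hψ
  have hψc : ContDiff ℝ ∞ ψ := ρ₀.contDiff_normed
  have hψs : tsupport ψ ⊆ Ioo 0 L := by
    rw [hψ, ρ₀.tsupport_normed_eq, Real.closedBall_eq_Icc]
    intro t ht
    simp only [ρ₀, mem_Icc] at ht
    constructor <;> linarith [ht.1, ht.2]
  have hψk : HasCompactSupport ψ := ρ₀.hasCompactSupport_normed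
  have hψi : ∫ t, ψ t = 1 := ρ₀.integral_normed
  -- With speed parameter `-v` the test function is at rest in the moving frame, so it stays
  -- supported inside the interval at all times.
  have hpair : ∀ (q : ℝ → ℝ → ℝ) t, pairing L v q ψ (-v) t =
      ∫ y in (0 : ℝ)..L, q (y + v * t) t * ψ y := by
    intro q t
    rw [pairing_eq]
    simp
  have hwhole : ∀ K : ℝ → ℝ, ∫ y in (0 : ℝ)..L, K y * ψ y = ∫ y, K y * ψ y := by
    intro K
    refine intervalIntegral.integral_eq_integral_of_support_subset ?_
    intro y hy
    exact Ioo_subset_Ioc_self (hψs (subset_tsupport _ (right_ne_zero_of_mul hy)))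
  have hcint : ∀ {K : ℝ → ℝ}, Continuous K → Integrable fun y => K y * ψ y := fun hK =>
    (hK.mul hψc.continuous).integrable_of_hasCompactSupport hψk.mul_left
  have hlint : ∀ {k : ℝ → ℝ}, MemLp k 2 volume → ∀ s, Integrable fun y => k (y + s) * ψ y := by
    intro k hk s
    have h1 := hk.comp_measurePreserving (measurePreserving_add_right volume s)
    exact h1.integrable_mul (hψc.continuous.memLp_of_hasCompactSupport (p := 2) hψk)
  set H : ℝ → ℝ := fun t => (∫ y, F (y + (v + 1) * t) * ψ y) -
    ∫ y, G (y + (v - 1) * t) * ψ y with hH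
  set H' : ℝ → ℝ := fun t => (v + 1) * (∫ y, f (y + (v + 1) * t) * ψ y) -
    (v - 1) * ∫ y, g (y + (v - 1) * t) * ψ y with hH'
  have hHd : ∀ t, HasDerivAt H (H' t) t := fun t =>
    (hasDerivAt_integral_primitive_mul hf hψc hψk (v + 1) t).sub
      (hasDerivAt_integral_primitive_mul hg hψc hψk (v - 1) t)
  set D : ℝ → ℝ := fun t => F ((v + 1) * t) - G ((v - 1) * t) with hD
  -- `D` is the unknown function of time left open by integrating `φ_x` in `x`. Below, `⟨φ, ψ⟩ = (H
  -- - D)/2` while its weak derivative is `H'/2`, so `D' = 0` weakly; and `D 0 = 0`.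
  have hDc : Continuous D := by fun_prop
  have hHc : Continuous H := continuous_iff_continuousAt.2 fun t => (hHd t).continuousAt
  have hpφ : ∀ t ∈ Icc 0 S, pairing L v φ ψ (-v) t = (H t - D t) / 2 := by
    intro t ht
    have e1 : pairing L v φ ψ (-v) t = ∫ y in (0 : ℝ)..L,
        ((F (y + (v + 1) * t) - G (y + (v - 1) * t) - D t) / 2) * ψ y := by
      rw [hpair]
      refine intervalIntegral.integral_congr fun y hy => ?_
      rw [uIcc_of_le hL.le] at hy
      rw [hrep t ht (y + v * t) ⟨by linarith [hy.1], by linarith [hy.2]⟩,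
        ← intervalIntegral.integral_interval_sub_left (hfi 0 _) (hfi 0 _),
        ← intervalIntegral.integral_interval_sub_left (hgi 0 _) (hgi 0 _),
        show y + v * t + t = y + (v + 1) * t by ring, show y + v * t - t = y + (v - 1) * t by ring,
        show v * t + t = (v + 1) * t by ring, show v * t - t = (v - 1) * t by ring]
      simp only [hD, hF, hG]
      ring
    rw [e1, hwhole]
    have e2 : ∀ y, ((F (y + (v + 1) * t) - G (y + (v - 1) * t) - D t) / 2) * ψ y =
        (F (y + (v + 1) * t) * ψ y - G (y + (v - 1) * t) * ψ y - D t * ψ y) / 2 := fun y => by ring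
    simp only [e2]
    rw [integral_div, integral_sub, integral_sub, integral_const_mul, hψi, mul_one]
    · exact hcint (by fun_prop)
    · exact hcint (by fun_prop)
    · exact (hcint (by fun_prop)).sub (hcint (by fun_prop))
    · exact hcint continuous_const
  have hpt : ∀ t ∈ Icc 0 S,
      pairing L v φt ψ (-v) t - -v * pairing L v φx ψ (-v) t = H' t / 2 := by
    intro t ht
    have e1 := pairing_add_const_mul hL hφ.continuous_dt hφ.continuous_dx v hψc.continuous (-v) ht
    rw [neg_mul, sub_neg_eq_add, ← e1, hpair]
    have e2 : ∫ y in (0 : ℝ)..L, (φt (y + v * t) t + v * φx (y + v * t) t) * ψ y =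
        ∫ y in (0 : ℝ)..L, (((v + 1) * f (y + (v + 1) * t) -
          (v - 1) * g (y + (v - 1) * t)) / 2) * ψ y := by
      refine intervalIntegral.integral_congr_ae ?_
      have h1 := (measurePreserving_add_right volume (v * t)).quasiMeasurePreserving.ae (hd t ht)
      have h2 : ∀ᵐ y : ℝ, y ≠ L := by simp [ae_iff]
      filter_upwards [h1, h2] with y hy hyL hym
      rw [uIoc_of_le hL.le] at hym
      have hlt : y < L := lt_of_le_of_ne hym.2 hyL
      obtain ⟨h3, h4⟩ := hy ⟨by linarith [hym.1], by linarith⟩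
      rw [h3, h4, show y + v * t + t = y + (v + 1) * t by ring,
        show y + v * t - t = y + (v - 1) * t by ring]
      ring
    rw [e2, hwhole]
    have e3 : ∀ y, (((v + 1) * f (y + (v + 1) * t) - (v - 1) * g (y + (v - 1) * t)) / 2) * ψ y =
        ((v + 1) * (f (y + (v + 1) * t) * ψ y) - (v - 1) * (g (y + (v - 1) * t) * ψ y)) / 2 :=
      fun y => by ring
    simp only [e3]
    rw [integral_div, integral_sub ((hlint hf _).const_mul _) ((hlint hg _).const_mul _),
      integral_const_mul, integral_const_mul]
  have hH'c : ContinuousOn H' (Icc 0 S) := by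
    have h1 := (hφ.continuous_dt.continuousOn_pairing hL hψc.continuous hψk (-v)).sub
      ((hφ.continuous_dx.continuousOn_pairing hL hψc.continuous hψk (-v)).const_mul (-v))
    refine (h1.const_mul 2).congr fun t ht => ?_
    simp only [Pi.sub_apply, hpt t ht]
    ring
  obtain ⟨c, hc⟩ := eqOn_const_of_integral_deriv_mul_eq_zero hS hDc.continuousOn (by
    intro θ hθ hθc hθs
    have hz : ∀ t, t ∉ Ioo 0 S → θ t = 0 := fun t ht =>
      image_eq_zero_of_notMem_tsupport fun h => ht (hθs h)
    have hθ' : Continuous (deriv θ) := (contDiff_infty_iff_deriv.1 hθ).2.continuous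
    have hw := hφ.integral_deriv_mul_pairing hL hS (m := -v) hθ hθc hψc hψk (by
      intro t ht u hu
      have := hψs hu
      exact ⟨hθs ht, by simp only; linarith [this.1], by simp only; linarith [this.2]⟩)
    have hiH' : IntervalIntegrable H' volume 0 S :=
      ContinuousOn.intervalIntegrable (by rwa [uIcc_of_le hS.le])
    have hpa := intervalIntegral.integral_mul_deriv_eq_deriv_mul (a := 0) (b := S)
      (u := θ) (v := H) (u' := deriv θ) (v' := H')
      (fun t _ => ((hθ.differentiable (by simp)) t).hasDerivAt) (fun t _ => hHd t)
      (hθ'.intervalIntegrable _ _) hiH'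
    rw [hz S (by simp), hz 0 (by simp), zero_mul, zero_mul, sub_zero, zero_sub] at hpa
    have e1 : ∫ t in (0 : ℝ)..S, deriv θ t * pairing L v φ ψ (-v) t =
        ∫ t in (0 : ℝ)..S, (deriv θ t * H t - deriv θ t * D t) / 2 := by
      refine intervalIntegral.integral_congr fun t ht => ?_
      rw [uIcc_of_le hS.le] at ht
      rw [hpφ t ht]
      ring
    have e2 : ∫ t in (0 : ℝ)..S,
        θ t * (pairing L v φt ψ (-v) t - -v * pairing L v φx ψ (-v) t) =
        ∫ t in (0 : ℝ)..S, (θ t * H' t) / 2 := by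
      refine intervalIntegral.integral_congr fun t ht => ?_
      rw [uIcc_of_le hS.le] at ht
      rw [hpt t ht]
      ring
    have hi1 : IntervalIntegrable (fun t => deriv θ t * H t) volume 0 S :=
      (hθ'.mul hHc).intervalIntegrable _ _
    have hi2 : IntervalIntegrable (fun t => deriv θ t * D t) volume 0 S :=
      (hθ'.mul hDc).intervalIntegrable _ _
    rw [e1, e2, intervalIntegral.integral_div, intervalIntegral.integral_div,
      intervalIntegral.integral_sub hi1 hi2, hpa] at hw
    rw [← intervalIntegral.integral_eq_integral_of_support_subset (a := 0) (b := S)]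
    · linarith
    · intro t ht
      exact Ioo_subset_Ioc_self (hθs (tsupport_deriv_subset (subset_tsupport _
        (left_ne_zero_of_mul ht)))))
  have h0 : D 0 = 0 := by simp [hD, hF, hG]
  have : D t = 0 := by rw [hc t ht, ← hc 0 ⟨le_rfl, hS.le⟩, h0]
  exact sub_eq_zero.1 this

end

/-! ### Boundary values of `φ_x` and the reflection law -/

theorem quasiMeasurePreserving_add_mul (a : ℝ) {c : ℝ} (hc : c ≠ 0) :
    Measure.QuasiMeasurePreserving (fun t : ℝ => a + c * t) volume volume := by
  have h : Measure.QuasiMeasurePreserving (fun t : ℝ => c * t) volume volume := by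
    refine ⟨measurable_const_mul c, fun s hs => ?_⟩
    rw [Real.map_volume_mul_left hc, Measure.smul_apply, hs, smul_zero]
  exact (measurePreserving_add_left volume a).quasiMeasurePreserving.comp h

theorem memLp_two_comp_add_mul {k : ℝ → ℝ} (hk : MemLp k 2 volume) (a : ℝ) {c : ℝ} (hc : c ≠ 0) :
    MemLp (fun t => k (a + c * t)) 2 volume := by
  refine (memLp_two_iff_integrable_sq
    (hk.aestronglyMeasurable.comp_quasiMeasurePreserving
      (quasiMeasurePreserving_add_mul a hc))).2 ?_
  exact (hk.integrable_sq.comp_add_left a).comp_mul_left' hc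

theorem ae_mul_eq_mul_of_primitive_eq {f g : ℝ → ℝ} (hf : MemLp f 2 volume)
    (hg : MemLp g 2 volume) {S a c d : ℝ} (hc : c ≠ 0) (hd : d ≠ 0)
    (h : ∀ t ∈ Icc 0 S, ∫ z in (0 : ℝ)..(a + c * t), f z = ∫ z in (0 : ℝ)..(a + d * t), g z) :
    ∀ᵐ t, t ∈ Ioo 0 S → c * f (a + c * t) = d * g (a + d * t) := by
  have hD : ∀ {k : ℝ → ℝ}, MemLp k 2 volume → ∀ {m : ℝ}, m ≠ 0 → ∀ᵐ t : ℝ,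
      HasDerivAt (fun t => ∫ z in (0 : ℝ)..(a + m * t), k z) (k (a + m * t) * m) t := by
    intro k hk m hm
    filter_upwards [(quasiMeasurePreserving_add_mul a hm).ae
      (LocallyIntegrable.ae_hasDerivAt_integral (hk.locallyIntegrable one_le_two))] with t ht
    have h2 : HasDerivAt (fun s => a + m * s) m t := by
      simpa using ((hasDerivAt_id t).const_mul m).const_add a
    exact (ht 0).comp t h2
  filter_upwards [hD hf hc, hD hg hd] with t h1 h2 ht
  have h3 := h1.congr_of_eventuallyEq (f₁ := fun t => ∫ z in (0 : ℝ)..(a + d * t), g z) (by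
    filter_upwards [isOpen_Ioo.mem_nhds ht] with s hs
    exact (h s (Ioo_subset_Icc_self hs)).symm)
  linarith [h3.unique h2]

section

variable {L v S : ℝ} {φ0 φ1 : ℝ → ℝ} {φ φx φt : ℝ → ℝ → ℝ}

/-- The boundary values of `φ_x`, in terms of the derivatives `f` and `g` of the two travelling
waves. -/
theorem IsSolution.exists_boundary_profiles (hL : 0 < L) (hv0 : 0 < v) (hv1 : v < 1) (hS : 0 < S)
    (hφ : IsSolution L v S φ0 φ1 φ φx φt) :
    ∃ f g : ℝ → ℝ, MemLp f 2 volume ∧ MemLp g 2 volume ∧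
      4 * energy L v φx φt 0 =
        (1 + v) * (∫ z in (0 : ℝ)..L, f z ^ 2) + (1 - v) * ∫ z in (0 : ℝ)..L, g z ^ 2 ∧
      ∀ᵐ t, t ∈ Ioo 0 S →
        (DifferentiableWithinAt ℝ (fun x => φ x t) (Icc (v * t) (L + v * t)) (v * t) ∧
          DifferentiableWithinAt ℝ (fun x => φ x t) (Icc (v * t) (L + v * t)) (L + v * t)) ∧
        (dxLeft L v φ t = f (0 + (1 + v) * t) / (1 - v) ∧
          dxRight L v φ t = f (L + (1 + v) * t) / (1 - v)) ∧
        (1 + v) * f (0 + (1 + v) * t) = (v - 1) * g (0 + (v - 1) * t) ∧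
        (1 + v) * f (L + (1 + v) * t) = (v - 1) * g (L + (v - 1) * t) := by
  obtain ⟨f, g, hf, hg, h⟩ := hφ.exists_dAlembert hL hS
  have hc : 1 + v ≠ 0 := by linarith
  have hd : v - 1 ≠ 0 := by linarith
  have hb : ∀ t ∈ Icc 0 S,
      ∫ z in (0 : ℝ)..(0 + (1 + v) * t), f z = ∫ z in (0 : ℝ)..(0 + (v - 1) * t), g z := by
    intro t ht
    have := hφ.primitive_eq_primitive hL hS hf hg (fun t ht => (h t ht).1)
      (fun t ht => (h t ht).2) ht
    rwa [zero_add, zero_add, add_comm 1 v]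
  have hfi := intervalIntegrable_of_memLp_two hf
  have hgi := intervalIntegrable_of_memLp_two hg
  have hb' : ∀ t ∈ Icc 0 S,
      ∫ z in (0 : ℝ)..(L + (1 + v) * t), f z = ∫ z in (0 : ℝ)..(L + (v - 1) * t), g z := by
    intro t ht
    have hle : v * t ≤ L + v * t := by linarith
    have h1 := (h t ht).2 (L + v * t) (right_mem_Icc.2 hle)
    rw [(hφ.memH10 t ht).right_eq_zero, show L + v * t + t = L + (1 + v) * t by ring,
      show L + v * t - t = L + (v - 1) * t by ring, show v * t + t = 0 + (1 + v) * t by ring,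
      show v * t - t = 0 + (v - 1) * t by ring] at h1
    rw [← intervalIntegral.integral_add_adjacent_intervals (hfi 0 (0 + (1 + v) * t)) (hfi _ _),
      ← intervalIntegral.integral_add_adjacent_intervals (hgi 0 (0 + (v - 1) * t)) (hgi _ _),
      hb t ht]
    linarith
  refine ⟨f, g, hf, hg, ?_, ?_⟩
  · have e : ∫ x in (v * 0)..(L + v * 0), ((φt x 0 + v * φx x 0) ^ 2 + (1 - v ^ 2) * φx x 0 ^ 2) =
        ∫ x in (0 : ℝ)..L, ((1 + v) * f x ^ 2 + (1 - v) * g x ^ 2) / 2 := by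
      rw [mul_zero, add_zero]
      refine intervalIntegral.integral_congr_ae ?_
      have hne : ∀ᵐ x : ℝ, x ≠ L := by simp [ae_iff]
      filter_upwards [(h 0 ⟨le_rfl, hS.le⟩).1, hne] with x hx hxL hxm
      rw [uIoc_of_le hL.le] at hxm
      obtain ⟨h1, h2⟩ := hx ⟨by linarith [hxm.1], by linarith [lt_of_le_of_ne hxm.2 hxL]⟩
      rw [add_zero, sub_zero] at h1 h2
      rw [h1, h2]
      ring
    rw [energy, e, intervalIntegral.integral_div,
      intervalIntegral.integral_add (hf.integrable_sq.intervalIntegrable.const_mul _)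
        (hg.integrable_sq.intervalIntegrable.const_mul _),
      intervalIntegral.integral_const_mul, intervalIntegral.integral_const_mul]
    ring
  -- The primitives of `f` and `g` live on the whole line and have two-sided derivatives almost
  -- everywhere. The maps `t ↦ a + (v ± 1)t` pull null sets back to null sets, so for almost every
  -- `t` the boundary point is a good point for both.
  have hder : ∀ a, (∀ t, v * t + a ∈ Icc (v * t) (L + v * t)) → ∀ᵐ t, t ∈ Ioo 0 S →
      HasDerivWithinAt (fun x => φ x t) ((f (a + (1 + v) * t) - g (a + (v - 1) * t)) / 2)
        (Icc (v * t) (L + v * t)) (v * t + a) := by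
    intro a ha
    filter_upwards [(quasiMeasurePreserving_add_mul a hc).ae
      (LocallyIntegrable.ae_hasDerivAt_integral (hf.locallyIntegrable one_le_two)),
      (quasiMeasurePreserving_add_mul a hd).ae
      (LocallyIntegrable.ae_hasDerivAt_integral (hg.locallyIntegrable one_le_two))] with t h1 h2 ht
    have h1 := h1 (v * t + t)
    have h2 := h2 (v * t - t)
    rw [show a + (1 + v) * t = v * t + a + t by ring] at h1 ⊢
    rw [show a + (v - 1) * t = v * t + a - t by ring] at h2 ⊢
    have h3 := ((h1.comp_add_const (v * t + a) t).sub
      (h2.comp_sub_const (v * t + a) t)).div_const 2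
    exact h3.hasDerivWithinAt.congr (fun x hx => (h t (Ioo_subset_Icc_self ht)).2 x hx)
      ((h t (Ioo_subset_Icc_self ht)).2 _ (ha t))
  filter_upwards [hder 0 (fun t => ⟨by linarith, by linarith⟩),
    hder L (fun t => ⟨by linarith, by linarith⟩), ae_mul_eq_mul_of_primitive_eq hf hg hc hd hb,
    ae_mul_eq_mul_of_primitive_eq hf hg hc hd hb'] with t h1 h2 h3 h4 ht
  have h1 := h1 ht
  have h2 := h2 ht
  have h3 := h3 ht
  have h4 := h4 ht
  rw [add_zero] at h1
  rw [add_comm (v * t) L] at h2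
  have hlt : v * t < L + v * t := by linarith
  have hu := uniqueDiffOn_Icc hlt
  have hv : (1 - v) ≠ 0 := by linarith
  have halg : ∀ p q : ℝ, (1 + v) * p = (v - 1) * q → (p - q) / 2 = p / (1 - v) := by
    intro p q hpq
    field_simp
    linarith
  refine ⟨⟨h1.differentiableWithinAt, h2.differentiableWithinAt⟩, ⟨?_, ?_⟩, h3, h4⟩
  · rw [dxLeft, h1.derivWithin (hu _ (left_mem_Icc.2 hlt.le)), halg _ _ h3]
  · rw [dxRight, h2.derivWithin (hu _ (right_mem_Icc.2 hlt.le)), halg _ _ h4]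

end

/-! ### Changes of variables and window counting -/

theorem integral_comp_add_mul_of_zero (h : ℝ → ℝ) (a T : ℝ) {c : ℝ} (hc : c ≠ 0) :
    c * ∫ t in (0 : ℝ)..T, h (a + c * t) = ∫ z in a..(a + c * T), h z := by
  rw [intervalIntegral.integral_comp_add_mul _ hc, mul_zero, add_zero, smul_eq_mul,
    mul_inv_cancel_left₀ hc]

/-- If the integral of `h ≥ 0` over the windows `[a, a + L]`, `0 ≤ a ≤ b`, is at most `C`, then
its integral over `[0, L + b]` is at most `C` times the number of windows. -/
theorem integral_le_nat_mul_of_window {h : ℝ → ℝ} (hh : ∀ a b, IntervalIntegrable h volume a b)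
    (h0 : ∀ z, 0 ≤ h z) {L b C : ℝ} (hL : 0 < L)
    (hw : ∀ a, 0 ≤ a → a ≤ b → ∫ z in a..(a + L), h z ≤ C) (hb : 0 ≤ b) (n : ℕ) :
    ∀ x, 0 ≤ x → x ≤ n * L → x ≤ L + b → ∫ z in (0 : ℝ)..x, h z ≤ n * C := by
  induction n with
  | zero =>
    intro x hx hxn _
    have : x = 0 := le_antisymm (by simpa using hxn) hx
    simp [this]
  | succ n ih =>
    intro x hx hxn hxb
    have hC : 0 ≤ C := (intervalIntegral.integral_nonneg (by linarith) fun z _ => h0 z).trans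
      (hw 0 le_rfl hb)
    have hn : (0 : ℝ) ≤ n * C := by positivity
    push_cast at hxn ⊢
    rcases le_total x L with hxL | hxL
    · have h1 := hw 0 le_rfl hb
      rw [zero_add] at h1
      have h2 : ∫ z in (0 : ℝ)..x, h z ≤ ∫ z in (0 : ℝ)..L, h z :=
        intervalIntegral.integral_mono_interval le_rfl hx hxL (ae_of_all _ h0) (hh _ _)
      linarith
    -- The last window `[x - L, x]` is split off; `x ≤ L + b` makes its starting point admissible.
    · have h1 := hw (x - L) (by linarith) (by linarith)
      rw [sub_add_cancel] at h1
      have h2 := ih (x - L) (by linarith) (by linarith) (by linarith)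
      rw [← intervalIntegral.integral_add_adjacent_intervals (hh 0 (x - L)) (hh _ x)]
      linarith

end TravellingString

/-! ### The identity, the direct inequality and observability -/

theorem theorem4p2 (L : ℝ) (hL : 0 < L) :
    ∃ K₂ : ℝ → ℝ → ℝ,
      ∀ (v : ℝ) (_hv0 : 0 < v) (_hv1 : v < 1) (S : ℝ) (_hS : 0 < S)
        (φ0 φ1 : ℝ → ℝ)
        (_hφ0 : ∃ φ0' : ℝ → ℝ, TravellingString.MemH10 0 L φ0 φ0')
        (_hφ1 : MemLp φ1 2 (volume.restrict (Ioo 0 L)))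
        (φ φx φt : ℝ → ℝ → ℝ)
        (_hφ : TravellingString.IsSolution L v S φ0 φ1 φ φx φt),
        -- the boundary values of `φ_x` exist for almost every time and are square integrable
        (∀ᵐ t ∂(volume.restrict (Ioo 0 S)),
          DifferentiableWithinAt ℝ (fun x => φ x t) (Icc (v * t) (L + v * t)) (v * t) ∧
          DifferentiableWithinAt ℝ (fun x => φ x t) (Icc (v * t) (L + v * t)) (L + v * t)) ∧
        MemLp (TravellingString.dxLeft L v φ) 2 (volume.restrict (Ioo 0 S)) ∧
        MemLp (TravellingString.dxRight L v φ) 2 (volume.restrict (Ioo 0 S)) ∧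
        -- the identity
        (L / (1 - v) ≤ S →
          (∫ t in (0 : ℝ)..(L / (1 + v)), TravellingString.dxLeft L v φ t ^ 2) +
            (∫ t in (0 : ℝ)..(L / (1 - v)), TravellingString.dxRight L v φ t ^ 2) =
          4 * TravellingString.energy L v φx φt 0 / (1 - v ^ 2) ^ 2) ∧
        -- the direct inequality
        (∀ T : ℝ, 0 ≤ T → T ≤ S →
          ∫ t in (0 : ℝ)..T,
              (TravellingString.dxLeft L v φ t ^ 2 + TravellingString.dxRight L v φ t ^ 2) ≤
            K₂ v T * TravellingString.energy L v φx φt 0) ∧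
        -- observability at both endpoints
        (∀ T : ℝ, L / (1 - v) ≤ T → T ≤ S →
          TravellingString.energy L v φx φt 0 ≤
            (1 - v ^ 2) ^ 2 / 4 *
              ∫ t in (0 : ℝ)..T,
                (TravellingString.dxLeft L v φ t ^ 2 +
                  TravellingString.dxRight L v φ t ^ 2)) := by
  -- Two traces, each controlled by `∫ f²` over `[0, L + (1 + v)T]`, which `⌈(1 + v)T/L⌉ + 1`
  -- windows cover at cost `4𝓔/(1 + v)` each; the change of variables divides by `(1 - v)² (1 + v)`.
  refine ⟨fun v T => 8 * (⌈(1 + v) * T / L⌉₊ + 1) / ((1 - v) ^ 2 * (1 + v) ^ 2), ?_⟩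
  intro v hv0 hv1 S hS φ0 φ1 _ _ φ φx φt hφ
  obtain ⟨f, g, hf, hg, hE, hae⟩ := hφ.exists_boundary_profiles hL hv0 hv1 hS
  have hp : 0 < 1 + v := by linarith
  have hm : 0 < 1 - v := by linarith
  have hm' : v - 1 ≠ 0 := by linarith
  set E := TravellingString.energy L v φx φt 0
  set h : ℝ → ℝ := fun z => f z ^ 2
  set k : ℝ → ℝ := fun z => g z ^ 2
  have hh0 : ∀ z, 0 ≤ h z := fun z => sq_nonneg _
  have hk0 : ∀ z, 0 ≤ k z := fun z => sq_nonneg _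
  have hhi : ∀ a b, IntervalIntegrable h volume a b := fun a b =>
    hf.integrable_sq.intervalIntegrable
  have hki : ∀ a b, IntervalIntegrable k volume a b := fun a b =>
    hg.integrable_sq.intervalIntegrable
  have hmem : ∀ a, MemLp (fun t => f (a + (1 + v) * t) / (1 - v)) 2
      (volume.restrict (Ioo 0 S)) := by
    intro a
    simp only [div_eq_mul_inv]
    exact (TravellingString.memLp_two_comp_add_mul hf a hp.ne').restrict _ |>.mul_const _
  have hl : MemLp (TravellingString.dxLeft L v φ) 2 (volume.restrict (Ioo 0 S)) := by
    refine (memLp_congr_ae ?_).1 (hmem 0)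
    refine (ae_restrict_iff' measurableSet_Ioo).2 ?_
    filter_upwards [hae] with t ht htm using (ht htm).2.1.1.symm
  have hr : MemLp (TravellingString.dxRight L v φ) 2 (volume.restrict (Ioo 0 S)) := by
    refine (memLp_congr_ae ?_).1 (hmem L)
    refine (ae_restrict_iff' measurableSet_Ioo).2 ?_
    filter_upwards [hae] with t ht htm using (ht htm).2.1.2.symm
  have hsqi : ∀ {q : ℝ → ℝ}, MemLp q 2 (volume.restrict (Ioo 0 S)) → ∀ {T}, 0 ≤ T → T ≤ S →
      IntervalIntegrable (fun t => q t ^ 2) volume 0 T := by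
    intro q hq T hT0 hTS
    rw [intervalIntegrable_iff_integrableOn_Ioo_of_le hT0]
    exact IntegrableOn.mono_set hq.integrable_sq (Ioo_subset_Ioo_right hTS)
  have hcongr : ∀ {p q : ℝ → ℝ}, (∀ᵐ t, t ∈ Ioo 0 S → p t = q t) → ∀ {T}, 0 ≤ T → T ≤ S →
      ∫ t in (0 : ℝ)..T, p t = ∫ t in (0 : ℝ)..T, q t := by
    intro p q hpq T hT0 hTS
    refine intervalIntegral.integral_congr_ae ?_
    have hne : ∀ᵐ t : ℝ, t ≠ S := by simp [ae_iff]
    filter_upwards [hpq, hne] with t ht htS htm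
    rw [uIoc_of_le hT0] at htm
    exact ht ⟨htm.1, lt_of_le_of_ne (htm.2.trans hTS) htS⟩
  have hwin : ∀ a T, (1 - v) ^ 2 * (1 + v) * ∫ t in (0 : ℝ)..T, (f (a + (1 + v) * t) / (1 - v)) ^ 2
      = ∫ z in a..(a + (1 + v) * T), h z := by
    intro a T
    rw [← TravellingString.integral_comp_add_mul_of_zero h a T hp.ne', mul_comm ((1 - v) ^ 2),
      mul_assoc, ← intervalIntegral.integral_const_mul]
    congr 1
    refine intervalIntegral.integral_congr fun t _ => ?_
    simp only [h]
    field_simp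
  have hleft : ∀ T, 0 ≤ T → T ≤ S →
      (1 - v) ^ 2 * (1 + v) * ∫ t in (0 : ℝ)..T, TravellingString.dxLeft L v φ t ^ 2 =
        ∫ z in (0 : ℝ)..((1 + v) * T), h z := by
    intro T hT0 hTS
    have := hwin 0 T
    rw [zero_add] at this
    rw [← this, hcongr (q := fun t => (f (0 + (1 + v) * t) / (1 - v)) ^ 2) ?_ hT0 hTS]
    filter_upwards [hae] with t ht htm
    rw [(ht htm).2.1.1]
  have hright : ∀ T, 0 ≤ T → T ≤ S →
      (1 - v) ^ 2 * (1 + v) * ∫ t in (0 : ℝ)..T, TravellingString.dxRight L v φ t ^ 2 =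
        ∫ z in L..(L + (1 + v) * T), h z := by
    intro T hT0 hTS
    rw [← hwin L T, hcongr (q := fun t => (f (L + (1 + v) * t) / (1 - v)) ^ 2) ?_ hT0 hTS]
    filter_upwards [hae] with t ht htm
    rw [(ht htm).2.1.2]
  -- The squared reflection law, integrated: `c² ∫ h(a + c t) dt` leaves one factor `c` after
  -- substitution, with `c = 1 + v` for `f` and `c = v - 1` for `g`.
  have hrefl : ∀ a, (∀ᵐ t, t ∈ Ioo 0 S → (1 + v) * f (a + (1 + v) * t) =
      (v - 1) * g (a + (v - 1) * t)) → ∀ T, 0 ≤ T → T ≤ S →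
      (1 + v) * ∫ z in a..(a + (1 + v) * T), h z =
        (v - 1) * ∫ z in a..(a + (v - 1) * T), k z := by
    intro a ha T hT0 hTS
    rw [← TravellingString.integral_comp_add_mul_of_zero h a T hp.ne',
      ← TravellingString.integral_comp_add_mul_of_zero k a T hm', ← mul_assoc, ← mul_assoc,
      ← intervalIntegral.integral_const_mul, ← intervalIntegral.integral_const_mul]
    refine hcongr ?_ hT0 hTS
    filter_upwards [ha] with t ht htm
    have := ht htm
    simp only [h, k]
    rw [← sq, ← sq, ← mul_pow, ← mul_pow, this]
  have hrefl0 := hrefl 0 (by filter_upwards [hae] with t ht htm using (ht htm).2.2.1)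
  have hreflL := hrefl L (by filter_upwards [hae] with t ht htm using (ht htm).2.2.2)
  have hident : L / (1 - v) ≤ S →
      (∫ t in (0 : ℝ)..(L / (1 + v)), TravellingString.dxLeft L v φ t ^ 2) +
        (∫ t in (0 : ℝ)..(L / (1 - v)), TravellingString.dxRight L v φ t ^ 2) =
      4 * E / (1 - v ^ 2) ^ 2 := by
    intro hLS
    have hle : L / (1 + v) ≤ L / (1 - v) := div_le_div_of_nonneg_left hL.le hm (by linarith)
    have h1 := hleft (L / (1 + v)) (by positivity) (hle.trans hLS)
    have h2 := hright (L / (1 - v)) (by positivity) hLS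
    have h3 := hreflL (L / (1 - v)) (by positivity) hLS
    rw [mul_div_cancel₀ _ hp.ne'] at h1
    rw [show (v - 1) * (L / (1 - v)) = -L by field_simp; ring, add_neg_cancel,
      intervalIntegral.integral_symm 0 L, ← h2] at h3
    have hv2 : (1 - v ^ 2) ^ 2 = (1 - v) ^ 2 * (1 + v) ^ 2 := by ring
    rw [hv2, eq_div_iff (by positivity)]
    linear_combination (1 + v) * h1 + h3 - hE
  have hsum : ∀ T, 0 ≤ T → T ≤ S → ∫ t in (0 : ℝ)..T,
      (TravellingString.dxLeft L v φ t ^ 2 + TravellingString.dxRight L v φ t ^ 2) =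
      (∫ t in (0 : ℝ)..T, TravellingString.dxLeft L v φ t ^ 2) +
        ∫ t in (0 : ℝ)..T, TravellingString.dxRight L v φ t ^ 2 := fun T hT0 hTS =>
    intervalIntegral.integral_add (hsqi hl hT0 hTS) (hsqi hr hT0 hTS)
  refine ⟨?_, hl, hr, hident, ?_, ?_⟩
  · refine (ae_restrict_iff' measurableSet_Ioo).2 ?_
    filter_upwards [hae] with t ht htm using (ht htm).1
  · intro T hT0 hTS
    have hwindow : ∀ a, 0 ≤ a → a ≤ (1 + v) * T → ∫ z in a..(a + L), h z ≤ 4 * E / (1 + v) := by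
      intro a ha0 haT
      have hat : (1 + v) * (a / (1 + v)) = a := mul_div_cancel₀ _ hp.ne'
      set t := a / (1 + v)
      have ht0 : 0 ≤ t := by positivity
      have htS : t ≤ S := (le_of_mul_le_mul_left (by rwa [hat]) hp).trans hTS
      have h1 := hrefl0 t ht0 htS
      have h2 := hreflL t ht0 htS
      rw [zero_add, zero_add, hat] at h1
      rw [hat] at h2
      -- By the two reflection laws, `(1 + v)∫ f²` over `[a, a + L]` plus `(1 - v)` times this
      -- integral equals `4𝓔`; dropping the `g` part gives the bound.
      have h3 : 0 ≤ ∫ z in ((v - 1) * t)..(L + (v - 1) * t), k z :=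
        intervalIntegral.integral_nonneg (by linarith) fun z _ => hk0 z
      rw [← intervalIntegral.integral_interval_sub_left (hki 0 _) (hki 0 _),
        ← intervalIntegral.integral_add_adjacent_intervals (hki 0 L) (hki L _)] at h3
      rw [le_div_iff₀ hp, add_comm a L,
        ← intervalIntegral.integral_interval_sub_left (hhi 0 _) (hhi 0 _),
        ← intervalIntegral.integral_add_adjacent_intervals (hhi 0 L) (hhi L _)]
      have h4 := mul_nonneg hm.le h3
      linarith
    set n := ⌈(1 + v) * T / L⌉₊
    have hb0 : 0 ≤ (1 + v) * T := by positivity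
    have hn : L + (1 + v) * T ≤ (n + 1 : ℕ) * L := by
      have := (div_le_iff₀ hL).1 (Nat.le_ceil ((1 + v) * T / L))
      push_cast
      linarith
    have h1 := TravellingString.integral_le_nat_mul_of_window hhi hh0 hL hwindow hb0 (n + 1)
      (L + (1 + v) * T) (by linarith) hn le_rfl
    have h2 : ∫ z in (0 : ℝ)..((1 + v) * T), h z ≤ ∫ z in (0 : ℝ)..(L + (1 + v) * T), h z :=
      intervalIntegral.integral_mono_interval le_rfl hb0 (by linarith) (ae_of_all _ hh0) (hhi _ _)
    have h3 : ∫ z in L..(L + (1 + v) * T), h z ≤ ∫ z in (0 : ℝ)..(L + (1 + v) * T), h z :=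
      intervalIntegral.integral_mono_interval hL.le (by linarith) le_rfl (ae_of_all _ hh0) (hhi _ _)
    rw [← hleft T hT0 hTS] at h2
    rw [← hright T hT0 hTS] at h3
    rw [hsum T hT0 hTS, div_mul_eq_mul_div, le_div_iff₀ (by positivity)]
    have h4 : ((n + 1 : ℕ) : ℝ) * (4 * E / (1 + v)) * (1 + v) = 4 * (n + 1) * E := by
      push_cast
      field_simp
    have h5 := mul_le_mul_of_nonneg_right ((add_le_add h2 h3).trans (add_le_add h1 h1)) hp.le
    linarith
  · intro T hLT hTS
    have hT0 : 0 ≤ T := le_trans (by positivity) hLT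
    have hle : L / (1 + v) ≤ L / (1 - v) := div_le_div_of_nonneg_left hL.le hm (by linarith)
    have h1 := hident (hLT.trans hTS)
    have h2 : ∫ t in (0 : ℝ)..(L / (1 + v)), TravellingString.dxLeft L v φ t ^ 2 ≤
        ∫ t in (0 : ℝ)..T, TravellingString.dxLeft L v φ t ^ 2 :=
      intervalIntegral.integral_mono_interval le_rfl (by positivity) (hle.trans hLT)
        (ae_of_all _ fun _ => sq_nonneg _) (hsqi hl hT0 hTS)
    have h3 : ∫ t in (0 : ℝ)..(L / (1 - v)), TravellingString.dxRight L v φ t ^ 2 ≤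
        ∫ t in (0 : ℝ)..T, TravellingString.dxRight L v φ t ^ 2 :=
      intervalIntegral.integral_mono_interval le_rfl (by positivity) hLT
        (ae_of_all _ fun _ => sq_nonneg _) (hsqi hr hT0 hTS)
    have hv2 : 0 < (1 - v ^ 2) ^ 2 := by
      have : 1 - v ^ 2 = (1 - v) * (1 + v) := by ring
      rw [this]
      positivity
    have h4 := (add_le_add h2 h3)
    rw [h1, ← hsum T hT0 hTS, div_le_iff₀ hv2] at h4
    linarith
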